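/- Let $0<\alpha\le 1$, $\arccos(\alpha/2)\le\theta<\pi$ and $h>0$, and let $T_{\alpha,\theta,h}$ be the open triangle with vertices $O=(0,0)$, $A=(h,0)$, $B=(\alpha h\cos\theta,\alpha h\sin\theta)$ and edges $e_1=OA$, $e_2=OB$, $e_3=AB$; put $T_{\alpha,\theta}=T_{\alpha,\theta,1}$. (Every triangle is congruent to some $T_{\alpha,\theta,h}$, $h$ being its medium edge length.) On each triangle let $\|v\|$ be the $L^2$ norm, $|v|_1=(\sum_i\|\partial_i v\|^2)^{1/2}$ and $|v|_2=(\sum_{i,j}\|\partial_i\partial_j v\|^2)^{1/2}$; integrals over edges of $H^1$ functions are taken in the sense of traces. Define $$V^0=\Big\{v\in H^1(T_{\alpha,\theta}):\int_{T_{\alpha,\theta}}v\,dx=0\Big\},\qquad V^J=\Big\{v\in H^1(T_{\alpha,\theta}):\int_{e_i}v\,ds=0\ (i\in J)\Big\}\ \ (J=\{1,2\},\{1,2,3\}),$$ $$V^4=\Big\{v\in H^2(T_{\alpha,\theta}):\int_{e_i}v\,ds=0\ (i=1,2,3)\Big\},$$ $$C_J(\alpha,\theta)=\sup_{0\ne v\in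 V^J}\frac{\|v\|}{|v|_1}\ \ (J=0,\{1,2\},\{1,2,3\}),\qquad C_4(\alpha,\theta)=\sup_{0\ne v\in V^4}\frac{|v|_1}{|v|_2},\qquad C_5(\alpha,\theta)=\sup_{0\ne v\in V^4}\frac{\|v\|}{|v|_2}.$$ For $v\in H^1(T_{\alpha,\theta,h})$ let $\Pi v$ be its Crouzeix–Raviart (non-conforming $P_1$) interpolant, i.e. the unique polynomial of degree at most one with $\int_{e_i}\Pi v\,ds=\int_{e_i}v\,ds$ for $i=1,2,3$. Then: (i) for all $\alpha,\theta$ as above, $C_4(\alpha,\theta)\le C_0(\alpha,\theta)$ and $C_5(\alpha,\theta)\le C_0(\alpha,\theta)\,C_{\{1,2,3\}}(\alpha,\theta)\le C_0(\alpha,\theta)\,C_{\{1,2\}}(\alpha,\theta)$; (ii) the interpolant $\Pi v$ exists and is unique for every $v\in H^1(T_{\alpha,\theta,h})$, and for every $v\in H^2(T_{\alpha,\theta,h})$ $$|v-\Pi v|_1\le C_4(\alpha,\theta)\,h\,|v|_2\le C_0(\alpha,\theta)\,h\,|v|_2,$$ $$\|v-\Pi v\|\le C_5(\alpha,\theta)\,h^2|v|_2\le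 C_0(\alpha,\theta)C_{\{1,2,3\}}(\alpha,\theta)\,h^2|v|_2\le C_0(\alpha,\theta)C_{\{1,2\}}(\alpha,\theta)\,h^2|v|_2;$$ (iii) no angle condition is needed: there is a finite constant $M$, independent of $\alpha$, $\theta$ and $h$, such that $C_0,C_{\{1,2\}},C_{\{1,2,3\}},C_4,C_5\le M$ for all $\alpha,\theta$ as above, and hence $|v-\Pi v|_1\le M h|v|_2$ and $\|v-\Pi v\|\le M h^2|v|_2$ for every $v\in H^2(T_{\alpha,\theta,h})$. -/

import Mathlib

open MeasureTheory Filter Topology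
open scoped ENNReal NNReal ContDiff

noncomputable section

namespace CRTri

/-- The Euclidean plane. -/
abbrev Plane : Type := EuclideanSpace ℝ (Fin 2)

/-! ### Sobolev spaces on an open set of the plane -/

/-- The classical partial derivative `∂φ/∂xᵢ`. -/
def partialDeriv (i : Fin 2) (φ : Plane → ℝ) (x : Plane) : ℝ :=
  fderiv ℝ φ x (EuclideanSpace.single i 1)

/-- `w ∈ L²(Ω)` is the weak partial derivative `∂v/∂xᵢ` of `v` in `Ω`. -/
def HasWeakDeriv (Ω : Set Plane) (i : Fin 2) (v w : Plane → ℝ) : Prop :=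
  MemLp w 2 (volume.restrict Ω) ∧
    ∀ φ : Plane → ℝ, ContDiff ℝ ∞ φ → HasCompactSupport φ → tsupport φ ⊆ Ω →
      ∫ x in Ω, v x * partialDeriv i φ x = -∫ x in Ω, w x * φ x

open Classical in
/-- The weak partial derivative `∂v/∂xᵢ` in `L²(Ω)` (unique almost everywhere in `Ω`),
where it exists. -/
def weakDeriv (Ω : Set Plane) (i : Fin 2) (v : Plane → ℝ) : Plane → ℝ :=
  if hv : ∃ w, HasWeakDeriv Ω i v w then hv.choose else 0

/-- `v ∈ H¹(Ω)`. -/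
def MemH1 (Ω : Set Plane) (v : Plane → ℝ) : Prop :=
  MemLp v 2 (volume.restrict Ω) ∧ ∀ i, ∃ w, HasWeakDeriv Ω i v w

/-- `v ∈ H²(Ω)`. -/
def MemH2 (Ω : Set Plane) (v : Plane → ℝ) : Prop :=
  MemH1 Ω v ∧ ∀ i, MemH1 Ω (weakDeriv Ω i v)

/-- The norm `‖v‖` of `L²(Ω)`. -/
def l2Norm (Ω : Set Plane) (v : Plane → ℝ) : ℝ≥0∞ :=
  eLpNorm v 2 (volume.restrict Ω)

/-- The semi-norm `|v|₁ = (∑ᵢ ‖∂ᵢv‖²)^(1/2)` of `H¹(Ω)`. -/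
def h1Semi (Ω : Set Plane) (v : Plane → ℝ) : ℝ≥0∞ :=
  (∑ i, l2Norm Ω (weakDeriv Ω i v) ^ 2) ^ (1 / 2 : ℝ)

/-- The semi-norm `|v|₂ = (∑ᵢⱼ ‖∂ᵢ∂ⱼv‖²)^(1/2)` of `H²(Ω)`. -/
def h2Semi (Ω : Set Plane) (v : Plane → ℝ) : ℝ≥0∞ :=
  (∑ i, ∑ j, l2Norm Ω (weakDeriv Ω i (weakDeriv Ω j v)) ^ 2) ^ (1 / 2 : ℝ)

/-! ### The triangle `T_{α,θ,h}` and its edges -/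

/-- The range of the shape parameters: `0 < α ≤ 1` and `arccos (α/2) ≤ θ < π`. -/
def ShapeRange (α θ : ℝ) : Prop :=
  0 < α ∧ α ≤ 1 ∧ Real.arccos (α / 2) ≤ θ ∧ θ < Real.pi

def vertexO : Plane := !₂[0, 0]

def vertexA (h : ℝ) : Plane := !₂[h, 0]

def vertexB (α θ h : ℝ) : Plane := !₂[α * h * Real.cos θ, α * h * Real.sin θ]

/-- The open triangle with vertices `O`, `A`, `B`. -/
def tri (α θ h : ℝ) : Set Plane :=
  interior (convexHull ℝ {vertexO, vertexA h, vertexB α θ h})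

/-- Starting points of the edges `e₁ = OA`, `e₂ = OB`, `e₃ = AB`, indexed by `0, 1, 2`. -/
def edgeStart (h : ℝ) : Fin 3 → Plane := ![vertexO, vertexO, vertexA h]

/-- End points of the edges `e₁ = OA`, `e₂ = OB`, `e₃ = AB`, indexed by `0, 1, 2`. -/
def edgeEnd (α θ h : ℝ) : Fin 3 → Plane := ![vertexA h, vertexB α θ h, vertexB α θ h]

/-- The affine parametrization of the `i`-th edge over `[0, 1]`. -/
def edgePath (α θ h : ℝ) (i : Fin 3) (t : ℝ) : Plane :=
  AffineMap.lineMap (edgeStart h i) (edgeEnd α θ h i) t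

/-- The line integral of `g` over the `i`-th edge with respect to arc length. -/
def lineIntegral (α θ h : ℝ) (i : Fin 3) (g : Plane → ℝ) : ℝ :=
  dist (edgeStart h i) (edgeEnd α θ h i) * ∫ t in (0 : ℝ)..1, g (edgePath α θ h i t)

/-- `g`, a function on the boundary of the triangle `T = T_{α,θ,h}` that is square integrable on
the edges, is the trace of `v ∈ H¹(T)`: some functions `φₙ`, smooth up to the boundary, tend to `v`
in `H¹(T)` while their restrictions to the edges tend to `g` in `L²`. -/
def IsTrace (α θ h : ℝ) (v g : Plane → ℝ) : Prop :=
  (∀ i, MemLp (fun t => g (edgePath α θ h i t)) 2 (volume.restrict (Set.Icc (0 : ℝ) 1))) ∧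
    ∃ φ : ℕ → Plane → ℝ,
      (∀ n, ContDiff ℝ ∞ (φ n)) ∧
      Tendsto (fun n => l2Norm (tri α θ h) (fun x => φ n x - v x)) atTop (𝓝 0) ∧
      (∀ i, Tendsto (fun n => l2Norm (tri α θ h)
        (fun x => partialDeriv i (φ n) x - weakDeriv (tri α θ h) i v x)) atTop (𝓝 0)) ∧
      (∀ i, Tendsto (fun n => eLpNorm
        (fun t => φ n (edgePath α θ h i t) - g (edgePath α θ h i t)) 2
        (volume.restrict (Set.Icc (0 : ℝ) 1))) atTop (𝓝 0))

open Classical in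
/-- The boundary trace of `v`. By the trace theorem every `v ∈ H¹(T)` has one, and it is unique
almost everywhere on the edges. -/
def bdryTrace (α θ h : ℝ) (v : Plane → ℝ) : Plane → ℝ :=
  if hv : ∃ g, IsTrace α θ h v g then hv.choose else 0

/-- `∫_{eᵢ} v ds` for `v ∈ H¹(T)`, in the sense of traces. -/
def edgeIntegral (α θ h : ℝ) (i : Fin 3) (v : Plane → ℝ) : ℝ :=
  lineIntegral α θ h i (bdryTrace α θ h v)

/-! ### The spaces `V^J` and the constants `C_J` -/

/-- `V⁰`: the functions of `H¹(T)` with integral zero. -/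
def V0 (α θ h : ℝ) : Set (Plane → ℝ) :=
  {v | MemH1 (tri α θ h) v ∧ ∫ x in tri α θ h, v x = 0}

/-- `V^J` for a set `J` of edges: the functions of `H¹(T)` with integral zero over each of them. -/
def VEdge (J : Set (Fin 3)) (α θ h : ℝ) : Set (Plane → ℝ) :=
  {v | MemH1 (tri α θ h) v ∧ ∀ i ∈ J, edgeIntegral α θ h i v = 0}

/-- `V⁴`: the functions of `H²(T)` with integral zero over each edge. -/
def V4 (α θ h : ℝ) : Set (Plane → ℝ) :=
  {v | MemH2 (tri α θ h) v ∧ ∀ i, edgeIntegral α θ h i v = 0}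

/-- The supremum of `N v / D v` over the `v ∈ V` that are not zero as elements of `L²(Ω)`. -/
def supQuot (Ω : Set Plane) (V : Set (Plane → ℝ)) (N D : (Plane → ℝ) → ℝ≥0∞) : ℝ≥0∞ :=
  ⨆ v ∈ {v ∈ V | ¬ v =ᵐ[volume.restrict Ω] 0}, N v / D v

/-- `C₀(α,θ,h)`. -/
def C0 (α θ h : ℝ) : ℝ≥0∞ :=
  supQuot (tri α θ h) (V0 α θ h) (l2Norm (tri α θ h)) (h1Semi (tri α θ h))

/-- `C_J(α,θ,h)` for a set `J` of edges. -/
def CEdge (J : Set (Fin 3)) (α θ h : ℝ) : ℝ≥0∞ :=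
  supQuot (tri α θ h) (VEdge J α θ h) (l2Norm (tri α θ h)) (h1Semi (tri α θ h))

/-- `C_{1,2}(α,θ,h)`. -/
def C12 (α θ h : ℝ) : ℝ≥0∞ := CEdge {0, 1} α θ h

/-- `C_{1,2,3}(α,θ,h)`. -/
def C123 (α θ h : ℝ) : ℝ≥0∞ := CEdge {0, 1, 2} α θ h

/-- `C₄(α,θ,h)`. -/
def C4 (α θ h : ℝ) : ℝ≥0∞ :=
  supQuot (tri α θ h) (V4 α θ h) (h1Semi (tri α θ h)) (h2Semi (tri α θ h))

/-- `C₅(α,θ,h)`. -/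
def C5 (α θ h : ℝ) : ℝ≥0∞ :=
  supQuot (tri α θ h) (V4 α θ h) (l2Norm (tri α θ h)) (h2Semi (tri α θ h))

/-- `p` is the non-conforming `P₁` (Crouzeix–Raviart) interpolant of `v ∈ H¹(T)`: the polynomial
of degree at most one with the same integrals over the three edges. -/
def IsCRInterpolant (α θ h : ℝ) (v : Plane → ℝ) (p : Plane →ᵃ[ℝ] ℝ) : Prop :=
  ∀ i, lineIntegral α θ h i p = edgeIntegral α θ h i v

end CRTri

end

open CRTri

/-! For a vertex `W` opposite to the edge `e`, the field `x - W` is tangent to the other two edges,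
so integrating `div ((x - W) v)` over `T` gives `2|T|` times the mean of `v` over `e`. Thus `∫_e v =
0` is equivalent to `∫_T (2v + (x - W)·∇v) = 0` (`rayMoment`, `edgeIntegral_eq`), a condition on the
interior only.

If all three edge integrals vanish, comparing the identity at two vertices gives `(W_i - W_j)·∫∇v =
0`, hence `∫ ∂ₖv = 0` (`integral_weakDeriv_eq_zero`). Each `∂ₖv` then lies in `V⁰`, which yields `C₄
≤ C₀`; since `V⁴ ⊆ V^{1,2,3} ⊆ V^{1,2}`, the bounds for `C₅` follow. The error `v - Πv` lies in `V⁴`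
and has the same second derivatives as `v`, so the error estimates follow by scaling to `h = 1`.

Uniformity in the shape comes from a Poincaré inequality on convex sets whose constant is twice a
bound for the diameter (`l2Norm_sub_average_le`), giving `C₀ ≤ 4`. If an edge integral vanishes, the
identity also bounds the mean of `v` by `∇v`, with a constant in which `|T|` cancels
(`l2Norm_average_le`); hence `C_{1,2} ≤ 8`, and 32 bounds everything.

The analytic groundwork is the density of smooth functions in `H¹` of a bounded convex open set
(`exists_contDiff_near`), which carries the Poincaré inequality, the existence of traces and the
edge identity over from smooth functions. -/

open CRTri

namespace CRTri

/-! ### Weak derivatives -/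

section WeakDerivatives

variable {Ω : Set Plane} {i : Fin 2} {v v' w w' : Plane → ℝ}

theorem isFiniteMeasure_restrict (hb : Bornology.IsBounded Ω) :
    IsFiniteMeasure (volume.restrict Ω) :=
  ⟨by simpa using hb.measure_lt_top⟩

theorem memLp_of_continuous (hb : Bornology.IsBounded Ω) (hΩ : MeasurableSet Ω)
    (hv : Continuous v) {p : ℝ≥0∞} : MemLp v p (volume.restrict Ω) := by
  have := isFiniteMeasure_restrict hb
  obtain ⟨C, hC⟩ := hb.isCompact_closure.exists_bound_of_continuousOn hv.continuousOn
  exact MemLp.of_bound hv.aestronglyMeasurable C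
    ((ae_restrict_iff' hΩ).2 (.of_forall fun x hx => hC x (subset_closure hx)))

theorem continuous_partialDeriv {φ : Plane → ℝ} (hφ : ContDiff ℝ 1 φ) (i : Fin 2) :
    Continuous (partialDeriv i φ) :=
  (hφ.continuous_fderiv one_ne_zero).clm_apply continuous_const

theorem hasCompactSupport_partialDeriv {φ : Plane → ℝ} (hφ : HasCompactSupport φ) (i : Fin 2) :
    HasCompactSupport (partialDeriv i φ) :=
  hφ.fderiv_apply (𝕜 := ℝ) (EuclideanSpace.single i 1)

theorem integrable_mul_of_hasCompactSupport (hb : Bornology.IsBounded Ω)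
    (hv : MemLp v 2 (volume.restrict Ω)) {ψ : Plane → ℝ} (hψ : Continuous ψ)
    (hc : HasCompactSupport ψ) : Integrable (fun x => v x * ψ x) (volume.restrict Ω) := by
  have := isFiniteMeasure_restrict hb
  obtain ⟨C, hC⟩ := hc.exists_bound_of_continuous hψ
  exact (hv.integrable one_le_two).mul_bdd (c := C) hψ.aestronglyMeasurable (.of_forall hC)

theorem HasWeakDeriv.congr (h : HasWeakDeriv Ω i v w) (hv : v =ᵐ[volume.restrict Ω] v')
    (hw : w =ᵐ[volume.restrict Ω] w') : HasWeakDeriv Ω i v' w' := by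
  refine ⟨h.1.ae_eq hw, fun φ h1 h2 h3 => ?_⟩
  have e1 := integral_congr_ae (hv.mul (ae_eq_refl (partialDeriv i φ)))
  have e2 := integral_congr_ae (hw.mul (ae_eq_refl φ))
  simp only [Pi.mul_apply] at e1 e2
  rw [← e1, ← e2]
  exact h.2 φ h1 h2 h3

/-- By the fundamental lemma of the calculus of variations. Since `weakDeriv` is an arbitrary
choice, every computation of it rests on this. -/
theorem HasWeakDeriv.unique (hΩ : IsOpen Ω) (hb : Bornology.IsBounded Ω)
    (h : HasWeakDeriv Ω i v w) (h' : HasWeakDeriv Ω i v w') : w =ᵐ[volume.restrict Ω] w' := by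
  have := isFiniteMeasure_restrict hb
  have hd : MemLp (w - w') 2 (volume.restrict Ω) := h.1.sub h'.1
  have key := hΩ.ae_eq_zero_of_integral_contDiff_smul_eq_zero (μ := volume) (f := w - w')
    (IntegrableOn.locallyIntegrableOn (hd.integrable one_le_two)) (by
      intro g h1 h2 h3
      have e1 := h.2 g h1 h2 h3
      have e2 := h'.2 g h1 h2 h3
      have hz : ∫ x, g x • (w - w') x = ∫ x in Ω, g x • (w - w') x := by
        refine (setIntegral_eq_integral_of_forall_compl_eq_zero fun x hx => ?_).symm
        rw [image_eq_zero_of_notMem_tsupport (fun hx' => hx (h3 hx')), zero_smul]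
      rw [hz]
      have : ∀ x, g x • (w - w') x = w x * g x - w' x * g x := fun x => by
        simp; ring
      simp_rw [this]
      rw [integral_sub (integrable_mul_of_hasCompactSupport hb h.1 h1.continuous h2)
        (integrable_mul_of_hasCompactSupport hb h'.1 h1.continuous h2)]
      linarith)
  filter_upwards [(ae_restrict_iff' hΩ.measurableSet).2 key] with x hx
  simpa [sub_eq_zero] using hx

theorem hasWeakDeriv_weakDeriv (h : ∃ w, HasWeakDeriv Ω i v w) :
    HasWeakDeriv Ω i v (weakDeriv Ω i v) := by
  rw [weakDeriv, dif_pos h]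
  exact h.choose_spec

theorem HasWeakDeriv.weakDeriv_ae_eq (hΩ : IsOpen Ω) (hb : Bornology.IsBounded Ω)
    (h : HasWeakDeriv Ω i v w) : weakDeriv Ω i v =ᵐ[volume.restrict Ω] w :=
  (hasWeakDeriv_weakDeriv ⟨w, h⟩).unique hΩ hb h

theorem HasWeakDeriv.sub (hb : Bornology.IsBounded Ω)
    (hv : MemLp v 2 (volume.restrict Ω)) (hv' : MemLp v' 2 (volume.restrict Ω))
    (h : HasWeakDeriv Ω i v w) (h' : HasWeakDeriv Ω i v' w') :
    HasWeakDeriv Ω i (fun x => v x - v' x) (fun x => w x - w' x) := by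
  refine ⟨h.1.sub h'.1, fun φ h1 h2 h3 => ?_⟩
  have hc := continuous_partialDeriv (h1.of_le (by exact_mod_cast le_top)) i
  have hs := hasCompactSupport_partialDeriv h2 i
  simp_rw [sub_mul]
  rw [integral_sub (integrable_mul_of_hasCompactSupport hb hv hc hs)
      (integrable_mul_of_hasCompactSupport hb hv' hc hs),
    integral_sub (integrable_mul_of_hasCompactSupport hb h.1 h1.continuous h2)
      (integrable_mul_of_hasCompactSupport hb h'.1 h1.continuous h2),
    h.2 φ h1 h2 h3, h'.2 φ h1 h2 h3]
  ring

theorem hasWeakDeriv_of_contDiff (hΩ : IsOpen Ω) (hb : Bornology.IsBounded Ω) {ψ : Plane → ℝ}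
    (hψ : ContDiff ℝ ∞ ψ) (i : Fin 2) : HasWeakDeriv Ω i ψ (partialDeriv i ψ) := by
  have hψ1 : ContDiff ℝ 1 ψ := hψ.of_le (by exact_mod_cast le_top)
  refine ⟨memLp_of_continuous hb hΩ.measurableSet (continuous_partialDeriv hψ1 i),
    fun φ h1 h2 h3 => ?_⟩
  have hφ1 : ContDiff ℝ 1 φ := h1.of_le (by exact_mod_cast le_top)
  have hz : ∀ x ∉ Ω, φ x = 0 := fun x hx =>
    image_eq_zero_of_notMem_tsupport fun hx' => hx (h3 hx')
  have hz' : ∀ x ∉ Ω, partialDeriv i φ x = 0 := fun x hx => by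
    have : x ∉ tsupport (fderiv ℝ φ) := fun hx' => hx (h3 (tsupport_fderiv_subset ℝ hx'))
    simp [partialDeriv, image_eq_zero_of_notMem_tsupport this]
  -- The test function and its derivatives vanish off `Ω`, so both integrals extend to the plane,
  -- where integration by parts has no boundary term.
  rw [setIntegral_eq_integral_of_forall_compl_eq_zero (fun x hx => by rw [hz' x hx, mul_zero]),
    setIntegral_eq_integral_of_forall_compl_eq_zero (fun x hx => by rw [hz x hx, mul_zero])]
  exact integral_mul_fderiv_eq_neg_fderiv_mul_of_integrable
    (((continuous_partialDeriv hψ1 i).mul h1.continuous).integrable_of_hasCompactSupport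
      h2.mul_left)
    ((hψ.continuous.mul (continuous_partialDeriv hφ1 i)).integrable_of_hasCompactSupport
      (hasCompactSupport_partialDeriv h2 i).mul_left)
    ((hψ.continuous.mul h1.continuous).integrable_of_hasCompactSupport h2.mul_left)
    (fun x _ => hψ1.differentiable one_ne_zero x) (fun x _ => hφ1.differentiable one_ne_zero x)

theorem MemH1.congr (h : MemH1 Ω v) (hv : v =ᵐ[volume.restrict Ω] v') : MemH1 Ω v' :=
  ⟨h.1.ae_eq hv, fun i => (h.2 i).imp fun _ hw => hw.congr hv (ae_eq_refl _)⟩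

theorem MemH1.sub (hb : Bornology.IsBounded Ω) (h : MemH1 Ω v) (h' : MemH1 Ω v') :
    MemH1 Ω (fun x => v x - v' x) :=
  ⟨h.1.sub h'.1, fun i =>
    ⟨_, (hasWeakDeriv_weakDeriv (h.2 i)).sub hb h.1 h'.1 (hasWeakDeriv_weakDeriv (h'.2 i))⟩⟩

theorem memH1_of_contDiff (hΩ : IsOpen Ω) (hb : Bornology.IsBounded Ω) {ψ : Plane → ℝ}
    (hψ : ContDiff ℝ ∞ ψ) : MemH1 Ω ψ :=
  ⟨memLp_of_continuous hb hΩ.measurableSet hψ.continuous,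
    fun i => ⟨_, hasWeakDeriv_of_contDiff hΩ hb hψ i⟩⟩

theorem weakDeriv_congr (hΩ : IsOpen Ω) (hb : Bornology.IsBounded Ω) (h : MemH1 Ω v)
    (hv : v =ᵐ[volume.restrict Ω] v') (i : Fin 2) :
    weakDeriv Ω i v =ᵐ[volume.restrict Ω] weakDeriv Ω i v' :=
  (((hasWeakDeriv_weakDeriv (h.2 i)).congr hv (ae_eq_refl _)).weakDeriv_ae_eq hΩ hb).symm

theorem weakDeriv_sub (hΩ : IsOpen Ω) (hb : Bornology.IsBounded Ω) (h : MemH1 Ω v)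
    (h' : MemH1 Ω v') (i : Fin 2) : weakDeriv Ω i (fun x => v x - v' x) =ᵐ[volume.restrict Ω]
      fun x => weakDeriv Ω i v x - weakDeriv Ω i v' x :=
  ((hasWeakDeriv_weakDeriv (h.2 i)).sub hb h.1 h'.1
    (hasWeakDeriv_weakDeriv (h'.2 i))).weakDeriv_ae_eq hΩ hb

theorem MemH1.memLp_weakDeriv (h : MemH1 Ω v) (i : Fin 2) :
    MemLp (weakDeriv Ω i v) 2 (volume.restrict Ω) :=
  (hasWeakDeriv_weakDeriv (h.2 i)).1

theorem h1Semi_eq_zero_of_ae_eq_zero (hΩ : IsOpen Ω) (hb : Bornology.IsBounded Ω)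
    (hv : v =ᵐ[volume.restrict Ω] 0) : h1Semi Ω v = 0 := by
  have hz : ∀ i, HasWeakDeriv Ω i v 0 := fun i =>
    HasWeakDeriv.congr (v := 0) (w := 0) ⟨MemLp.zero, by simp⟩ hv.symm (ae_eq_refl _)
  have : ∀ i, l2Norm Ω (weakDeriv Ω i v) = 0 := fun i => by
    rw [l2Norm, eLpNorm_congr_ae ((hz i).weakDeriv_ae_eq hΩ hb), eLpNorm_zero]
  simp [h1Semi, this]

/-! ### Scaling -/

section Scaling

variable {Ω' : Set Plane} {h : ℝ}

theorem map_smul_restrict (hh : 0 < h) (hΩ' : Ω' = (fun x : Plane => h • x) ⁻¹' Ω) :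
    Measure.map (fun x : Plane => h • x) (volume.restrict Ω') =
      ENNReal.ofReal ((h ^ 2)⁻¹) • volume.restrict Ω := by
  have he : MeasurableEmbedding (fun x : Plane => h • x) :=
    (Homeomorph.smulOfNeZero h hh.ne').measurableEmbedding
  rw [hΩ', ← he.restrict_map, Measure.map_addHaar_smul _ hh.ne', Measure.restrict_smul]
  congr 2
  rw [abs_of_pos (by positivity)]
  simp

theorem integral_comp_smul_restrict (hh : 0 < h) (hΩ' : Ω' = (fun x : Plane => h • x) ⁻¹' Ω)
    (f : Plane → ℝ) : ∫ x in Ω', f (h • x) = (h ^ 2)⁻¹ * ∫ x in Ω, f x := by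
  have he : MeasurableEmbedding (fun x : Plane => h • x) :=
    (Homeomorph.smulOfNeZero h hh.ne').measurableEmbedding
  rw [← he.integral_map, map_smul_restrict hh hΩ', integral_smul_measure,
    ENNReal.toReal_ofReal (by positivity), smul_eq_mul]

theorem memLp_comp_smul (hh : 0 < h) (hΩ' : Ω' = (fun x : Plane => h • x) ⁻¹' Ω)
    (hv : MemLp v 2 (volume.restrict Ω)) :
    MemLp (fun x => v (h • x)) 2 (volume.restrict Ω') := by
  have : MemLp v 2 (Measure.map (fun x : Plane => h • x) (volume.restrict Ω')) := by
    rw [map_smul_restrict hh hΩ']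
    exact hv.smul_measure ENNReal.ofReal_ne_top
  exact this.comp_of_map (measurable_const_smul h).aemeasurable

theorem l2Norm_comp_smul (hh : 0 < h) (hΩ' : Ω' = (fun x : Plane => h • x) ⁻¹' Ω)
    (v : Plane → ℝ) : l2Norm Ω v = ENNReal.ofReal h * l2Norm Ω' (fun x => v (h • x)) := by
  have he : MeasurableEmbedding (fun x : Plane => h • x) :=
    (Homeomorph.smulOfNeZero h hh.ne').measurableEmbedding
  have := he.eLpNorm_map_measure (g := v) (p := 2) (μ := volume.restrict Ω')
  rw [map_smul_restrict hh hΩ', eLpNorm_smul_measure_of_ne_top (by simp)] at this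
  rw [l2Norm, l2Norm]
  change _ = _ * eLpNorm (v ∘ fun x => h • x) _ _
  rw [← this, smul_eq_mul, ← mul_assoc, ENNReal.ofReal_rpow_of_pos (by positivity),
    ← ENNReal.ofReal_mul hh.le]
  -- The Jacobian `h⁻²` enters an `L²` norm through its square root.
  have : h * (h ^ 2)⁻¹ ^ (1 / (2 : ℝ≥0∞)).toReal = 1 := by
    rw [Real.inv_rpow (by positivity), ← Real.rpow_natCast, ← Real.rpow_mul hh.le]
    simp [hh.ne']
  rw [this, ENNReal.ofReal_one, one_mul]

theorem HasWeakDeriv.comp_smul (hh : 0 < h) (hΩ' : Ω' = (fun x : Plane => h • x) ⁻¹' Ω)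
    (hw : HasWeakDeriv Ω i v w) :
    HasWeakDeriv Ω' i (fun x => v (h • x)) (fun x => h * w (h • x)) := by
  refine ⟨(memLp_comp_smul hh hΩ' hw.1).const_mul h, fun φ h1 h2 h3 => ?_⟩
  set ψ : Plane → ℝ := fun y => φ (h⁻¹ • y) with hψ
  have hψc : ContDiff ℝ ∞ ψ := h1.comp (contDiff_const_smul _)
  have hψs : HasCompactSupport ψ :=
    h2.comp_homeomorph (Homeomorph.smulOfNeZero h⁻¹ (inv_ne_zero hh.ne'))
  have hψt : tsupport ψ ⊆ Ω := by
    have : tsupport ψ ⊆ (fun y : Plane => h⁻¹ • y) ⁻¹' tsupport φ :=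
      closure_minimal (fun y hy => subset_closure hy)
        ((isClosed_tsupport φ).preimage (continuous_const_smul _))
    intro y hy
    have := h3 (this hy)
    rw [hΩ'] at this
    simpa [smul_smul, hh.ne'] using this
  have hd : ∀ x, partialDeriv i φ x = h * partialDeriv i ψ (h • x) := by
    intro x
    have e : φ = fun x => ψ (h • x) := by
      ext x; simp [hψ, smul_smul, hh.ne']
    have hf : HasFDerivAt φ ((fderiv ℝ ψ (h • x)).comp (h • ContinuousLinearMap.id ℝ Plane)) x := by
      rw [e]
      have h5 := (hψc.differentiable (by simp) (h • x)).hasFDerivAt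
      exact h5.comp x (((hasFDerivAt_id x).const_smul h))
    rw [partialDeriv, hf.fderiv]
    simp [partialDeriv]
  have hφ : ∀ x, φ x = ψ (h • x) := fun x => by simp [hψ, smul_smul, hh.ne']
  have e1 := integral_comp_smul_restrict hh hΩ' (fun y => v y * partialDeriv i ψ y)
  have e2 := integral_comp_smul_restrict hh hΩ' (fun y => w y * ψ y)
  have e3 := hw.2 ψ hψc hψs hψt
  calc ∫ x in Ω', v (h • x) * partialDeriv i φ x
      = ∫ x in Ω', h * (v (h • x) * partialDeriv i ψ (h • x)) := by
        congr 1; ext x; rw [hd]; ring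
    _ = -(h * ∫ x in Ω', w (h • x) * ψ (h • x)) := by
        rw [integral_const_mul, e1, e2, e3]; ring
    _ = -∫ x in Ω', h * w (h • x) * φ x := by
        rw [← integral_const_mul]; congr 2; ext x; rw [hφ]; ring

theorem MemH1.comp_smul (hh : 0 < h) (hΩ' : Ω' = (fun x : Plane => h • x) ⁻¹' Ω)
    (hv : MemH1 Ω v) : MemH1 Ω' (fun x => v (h • x)) :=
  ⟨memLp_comp_smul hh hΩ' hv.1, fun i =>
    ⟨_, (hasWeakDeriv_weakDeriv (hv.2 i)).comp_smul hh hΩ'⟩⟩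

end Scaling

end WeakDerivatives

/-! ### Averages in `L²` -/

theorem eLpNorm_two_sq {α : Type*} [MeasurableSpace α] (μ : Measure α) (f : α → ℝ) :
    eLpNorm f 2 μ ^ 2 = ∫⁻ x, ‖f x‖ₑ ^ 2 ∂μ := by
  have := eLpNorm_nnreal_pow_eq_lintegral (f := f) (μ := μ) (p := 2) two_ne_zero
  simpa using this

/-- Jensen's inequality for the square. -/
theorem enorm_integral_sub_sq_le {α : Type*} [MeasurableSpace α] (ν : Measure α)
    [IsProbabilityMeasure ν] {f : α → ℝ} (hf : AEStronglyMeasurable f ν) (c : ℝ) :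
    ‖∫ z, f z ∂ν - c‖ₑ ^ 2 ≤ ∫⁻ z, ‖f z - c‖ₑ ^ 2 ∂ν := by
  have hm : AEStronglyMeasurable (fun z => f z - c) ν := hf.sub aestronglyMeasurable_const
  rw [← eLpNorm_two_sq ν (fun z => f z - c)]
  by_cases htop : eLpNorm (fun z => f z - c) 2 ν = ⊤
  · simp [htop]
  have hL : MemLp (fun z => f z - c) 2 ν := ⟨hm, lt_top_iff_ne_top.2 htop⟩
  have hi : Integrable f ν := by
    exact ((hL.integrable one_le_two).add (integrable_const c)).congr
      (.of_forall fun z => by simp)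
  gcongr
  calc ‖∫ z, f z ∂ν - c‖ₑ = ‖∫ z, (f z - c) ∂ν‖ₑ := by
        rw [integral_sub hi (integrable_const c)]; simp
    _ ≤ ∫⁻ z, ‖f z - c‖ₑ ∂ν := enorm_integral_le_lintegral_enorm _
    _ = eLpNorm (fun z => f z - c) 1 ν := eLpNorm_one_eq_lintegral_enorm.symm
    _ ≤ _ := eLpNorm_le_eLpNorm_of_exponent_le one_le_two hm

/-! ### Contractions of a convex set towards one of its points -/

section Contraction

variable {Ω : Set Plane} {v w : Plane → ℝ}

/-- Convexity keeps the contraction inside `Ω`, and its Jacobian `(1 - t)²` is at least `1/4`. The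
factor 4 does not depend on the centre `z`; both the density theorem and the Poincaré inequality use
this. -/
theorem map_contraction_le (hΩ : MeasurableSet Ω) (hconv : Convex ℝ Ω) {z : Plane} (hz : z ∈ Ω)
    {t : ℝ} (ht0 : 0 ≤ t) (ht : t ≤ 1 / 2) :
    Measure.map (fun x : Plane => (1 - t) • x + t • z) (volume.restrict Ω) ≤
      (4 : ℝ≥0∞) • volume.restrict Ω := by
  have hmeas : Measurable (fun x : Plane => (1 - t) • x + t • z) := by fun_prop
  have hmap : Measure.map (fun x : Plane => (1 - t) • x + t • z) volume =
      ENNReal.ofReal |((1 - t) ^ 2)⁻¹| • (volume : Measure Plane) := by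
    have : (fun x : Plane => (1 - t) • x + t • z) =
        (fun y => y + t • z) ∘ (fun x : Plane => (1 - t) • x) := rfl
    rw [this, ← Measure.map_map (by fun_prop) (by fun_prop),
      Measure.map_addHaar_smul _ (by linarith), Measure.map_smul, map_add_right_eq_self]
    simp
  have hsub : Ω ⊆ (fun x : Plane => (1 - t) • x + t • z) ⁻¹' Ω := fun x hx =>
    hconv hx hz (by linarith) ht0 (by ring)
  calc Measure.map (fun x : Plane => (1 - t) • x + t • z) (volume.restrict Ω)
      ≤ Measure.map (fun x : Plane => (1 - t) • x + t • z)
          (volume.restrict ((fun x : Plane => (1 - t) • x + t • z) ⁻¹' Ω)) :=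
        Measure.map_mono (Measure.restrict_mono_set _ hsub) hmeas
    _ = ENNReal.ofReal |((1 - t) ^ 2)⁻¹| • volume.restrict Ω := by
        rw [← Measure.restrict_map hmeas hΩ, hmap, Measure.restrict_smul]
    _ ≤ _ := by
        gcongr
        rw [show (4 : ℝ≥0∞) = ENNReal.ofReal 4 by simp]
        apply ENNReal.ofReal_le_ofReal
        rw [abs_of_nonneg (by positivity), inv_le_comm₀ (by nlinarith) (by norm_num)]
        nlinarith

theorem lintegral_contraction_le (hΩ : MeasurableSet Ω) (hconv : Convex ℝ Ω) {z : Plane}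
    (hz : z ∈ Ω) {t : ℝ} (ht0 : 0 ≤ t) (ht : t ≤ 1 / 2) {f : Plane → ℝ≥0∞} (hf : Measurable f) :
    ∫⁻ x in Ω, f ((1 - t) • x + t • z) ≤ 4 * ∫⁻ x in Ω, f x := by
  have hmeas : Measurable (fun x : Plane => (1 - t) • x + t • z) := by fun_prop
  rw [← lintegral_map hf hmeas, ← smul_eq_mul, ← lintegral_smul_measure]
  exact lintegral_mono' (map_contraction_le hΩ hconv hz ht0 ht) le_rfl

theorem eLpNorm_contraction_le (hΩ : MeasurableSet Ω) (hconv : Convex ℝ Ω) {z : Plane}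
    (hz : z ∈ Ω) {t : ℝ} (ht0 : 0 ≤ t) (ht : t ≤ 1 / 2) {f : Plane → ℝ} (hf : Measurable f) :
    eLpNorm (fun x => f ((1 - t) • x + t • z)) 2 (volume.restrict Ω) ≤
      2 * eLpNorm f 2 (volume.restrict Ω) := by
  rw [← ENNReal.pow_le_pow_left_iff two_ne_zero, mul_pow, eLpNorm_two_sq, eLpNorm_two_sq]
  have := lintegral_contraction_le hΩ hconv hz ht0 ht (f := fun x => ‖f x‖ₑ ^ 2)
    (by fun_prop)
  norm_num
  exact this

/-- Contractions converge strongly to the identity on `L²`, uniformly in the centre: `v` is replaced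
by a uniformly continuous `g`, and the contraction moves a point by `t‖z - x‖`. -/
theorem exists_eLpNorm_contraction_sub_le (hΩ : MeasurableSet Ω) (hb : Bornology.IsBounded Ω)
    (hconv : Convex ℝ Ω) (hv : MemLp v 2 (volume.restrict Ω)) (hvm : Measurable v)
    {δ : ℝ≥0∞} (hδ : δ ≠ 0) :
    ∃ t₀ > 0, ∀ t : ℝ, 0 ≤ t → t ≤ t₀ → ∀ z ∈ Ω,
      eLpNorm (fun x => v ((1 - t) • x + t • z) - v x) 2 (volume.restrict Ω) ≤ δ := by
  have hfin := isFiniteMeasure_restrict hb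
  -- Contracting `v - g` at most doubles its norm, so the three errors add up to `2(δ/6) + δ/2 + δ/6
  -- = δ`.
  obtain ⟨g, hgs, hgv, hgc, hgL⟩ := hv.exists_hasCompactSupport_eLpNorm_sub_le
    (ε := δ / 6) (by simp) (ENNReal.div_ne_zero.2 ⟨hδ, by simp⟩)
  obtain ⟨d, hd⟩ := hb.exists_norm_le
  obtain ⟨c, hc0, hc⟩ : ∃ c : ℝ, 0 < c ∧
      volume.restrict Ω Set.univ ^ (1 / (2 : ℝ≥0∞).toReal) * ENNReal.ofReal c ≤ δ / 2 := by
    by_cases hδt : δ = ⊤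
    · exact ⟨1, one_pos, by simp [hδt, ENNReal.top_div]⟩
    set m := volume.restrict Ω Set.univ ^ (1 / (2 : ℝ≥0∞).toReal)
    have hm : m ≠ ⊤ := ENNReal.rpow_ne_top_of_nonneg (by positivity) (measure_ne_top _ _)
    -- Dividing by `m + 1` instead of `m` also covers a null set `Ω`.
    have h2 : (m + 1)⁻¹ * (δ / 2) ≠ ⊤ :=
      ENNReal.mul_ne_top (by simp) (ENNReal.div_ne_top hδt (by simp))
    have h3 : (m + 1)⁻¹ * (δ / 2) ≠ 0 :=
      mul_ne_zero (ENNReal.inv_ne_zero.2 (by simp [hm])) (ENNReal.div_ne_zero.2 ⟨hδ, by simp⟩)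
    refine ⟨((m + 1)⁻¹ * (δ / 2)).toReal, ENNReal.toReal_pos h3 h2, ?_⟩
    rw [ENNReal.ofReal_toReal h2, ← mul_assoc]
    refine mul_le_of_le_one_left' ?_
    calc m * (m + 1)⁻¹ ≤ (m + 1) * (m + 1)⁻¹ := by gcongr; exact le_self_add
      _ ≤ 1 := ENNReal.mul_inv_le_one _
  obtain ⟨r, hr0, hr⟩ := Metric.uniformContinuous_iff.1
    (hgs.uniformContinuous_of_continuous hgc) c hc0
  have hd' : 0 < 2 * |d| + 1 := by positivity
  refine ⟨min (1 / 2) (r / (2 * (2 * |d| + 1))), by positivity, fun t ht0 ht z hz => ?_⟩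
  have ht2 : t ≤ 1 / 2 := ht.trans (min_le_left _ _)
  have htr : t * (2 * |d|) < r := by
    have : t ≤ r / (2 * (2 * |d| + 1)) := ht.trans (min_le_right _ _)
    rw [le_div_iff₀ (by positivity)] at this
    nlinarith [abs_nonneg d]
  set E : Plane → Plane := fun x => (1 - t) • x + t • z with hE
  have hEm : Measurable E := by fun_prop
  have h1 : eLpNorm (fun x => v (E x) - g (E x)) 2 (volume.restrict Ω) ≤ 2 * (δ / 6) :=
    (eLpNorm_contraction_le hΩ hconv hz ht0 ht2 (f := v - g)
      (hvm.sub hgc.measurable)).trans (by gcongr)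
  have h2 : eLpNorm (fun x => g (E x) - g x) 2 (volume.restrict Ω) ≤ δ / 2 := by
    refine (eLpNorm_le_of_ae_bound (C := c) ?_).trans ?_
    · refine (ae_restrict_iff' hΩ).2 (.of_forall fun x hx => ?_)
      rw [← dist_eq_norm]
      refine (hr ?_).le
      rw [dist_eq_norm, show E x - x = t • (z - x) by simp only [hE]; module, norm_smul,
        Real.norm_of_nonneg ht0]
      refine lt_of_le_of_lt (mul_le_mul_of_nonneg_left ?_ ht0) htr
      have := norm_sub_le z x
      have h3 := hd z hz
      have h4 := hd x hx
      have := le_abs_self d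
      linarith
    · simpa using hc
  have h3 : eLpNorm (fun x => g x - v x) 2 (volume.restrict Ω) ≤ δ / 6 := by
    rw [← Pi.sub_def, eLpNorm_sub_comm]; exact hgv
  have hgm := hgc.measurable
  calc eLpNorm (fun x => v (E x) - v x) 2 (volume.restrict Ω)
      = eLpNorm ((fun x => v (E x) - g (E x)) + ((fun x => g (E x) - g x) + fun x => g x - v x)) 2
          (volume.restrict Ω) := by
        congr 1; ext x; simp
    _ ≤ 2 * (δ / 6) + (δ / 2 + δ / 6) := by
        refine (eLpNorm_add_le ?_ ?_ one_le_two).trans (add_le_add h1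
          ((eLpNorm_add_le ?_ ?_ one_le_two).trans (add_le_add h2 h3)))
        all_goals exact Measurable.aestronglyMeasurable (by fun_prop)
    _ = δ := by
        rw [show δ / 2 = 3 * (δ / 6) by
          rw [ENNReal.div_eq_inv_mul, ENNReal.div_eq_inv_mul, ← mul_assoc]
          congr 1
          rw [show (6 : ℝ≥0∞) = 3 * 2 by norm_num, ENNReal.mul_inv (by simp) (by simp), ← mul_assoc,
            ENNReal.mul_inv_cancel (by simp) (by simp), one_mul]]
        rw [show 2 * (δ / 6) + (3 * (δ / 6) + δ / 6) = 6 * (δ / 6) by ring]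
        exact ENNReal.mul_div_cancel (by simp) (by simp)

/-- Jensen's inequality in `z`, then Tonelli: an average over centres is no worse than the uniform
bound for a single centre. -/
theorem l2Norm_average_sub_le (ν : Measure Plane) [IsProbabilityMeasure ν]
    (hν : ∀ᵐ z ∂ν, z ∈ Ω) (hvm : Measurable v) {t : ℝ} {δ : ℝ≥0∞}
    (h : ∀ z ∈ Ω, eLpNorm (fun x => v ((1 - t) • x + t • z) - v x) 2 (volume.restrict Ω) ≤ δ) :
    l2Norm Ω (fun x => ∫ z, v ((1 - t) • x + t • z) ∂ν - v x) ≤ δ := by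
  rw [l2Norm, ← ENNReal.pow_le_pow_left_iff two_ne_zero, eLpNorm_two_sq]
  calc ∫⁻ x in Ω, ‖∫ z, v ((1 - t) • x + t • z) ∂ν - v x‖ₑ ^ 2
      ≤ ∫⁻ x in Ω, ∫⁻ z, ‖v ((1 - t) • x + t • z) - v x‖ₑ ^ 2 ∂ν :=
        lintegral_mono fun x => enorm_integral_sub_sq_le ν
          (Measurable.aestronglyMeasurable (by fun_prop)) _
    _ = ∫⁻ z, (∫⁻ x in Ω, ‖v ((1 - t) • x + t • z) - v x‖ₑ ^ 2) ∂ν :=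
        lintegral_lintegral_swap (Measurable.aemeasurable (by fun_prop))
    _ ≤ ∫⁻ _, δ ^ 2 ∂ν := by
        refine lintegral_mono_ae (hν.mono fun z hz => ?_)
        rw [← eLpNorm_two_sq (volume.restrict Ω) (fun x => v ((1 - t) • x + t • z) - v x)]
        exact pow_le_pow_left' (h z hz) 2
    _ = δ ^ 2 := by simp

end Contraction

/-! ### Density of the smooth functions in `H¹` of a bounded convex open set -/

section Smoothing

open scoped Convolution

variable {Ω : Set Plane} {v w η : Plane → ℝ} {t : ℝ}

/-- The weighted average of `v` over the contractions of rate `t` towards the points of `Ω`. -/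
noncomputable def smoothing (Ω : Set Plane) (η : Plane → ℝ) (t : ℝ) (v : Plane → ℝ) (x : Plane) : ℝ :=
  ∫ z, η z * Ω.indicator v ((1 - t) • x + t • z)

/-- The kernel that represents `smoothing` as a convolution. -/
noncomputable def smoothingKernel (η : Plane → ℝ) (t : ℝ) (y : Plane) : ℝ :=
  (t ^ 2)⁻¹ * η (-(t⁻¹ • y))

/-- The substitution `u = (1 - t)x + tz` turns the average over centres into a convolution evaluated
at `(1 - t)x`. This makes it smooth on the whole plane, hence up to the boundary of `Ω`. -/
theorem smoothing_eq_convolution (ht : 0 < t) (x : Plane) :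
    smoothing Ω η t v x =
      (Ω.indicator v ⋆[ContinuousLinearMap.mul ℝ ℝ, volume] smoothingKernel η t)
        ((1 - t) • x) := by
  rw [convolution_def]
  set u := Ω.indicator v
  have h1 := Measure.integral_comp_smul (volume : Measure Plane)
    (fun y => u ((1 - t) • x + y) * smoothingKernel η t (-y)) t
  have h2 := integral_add_left_eq_self (μ := (volume : Measure Plane))
    (fun y => u y * smoothingKernel η t ((1 - t) • x - y)) ((1 - t) • x)
  simp only [ContinuousLinearMap.mul_apply']
  rw [← h2, smoothing]
  have h3 : ∀ y, (1 - t) • x - ((1 - t) • x + y) = -y := fun y => by abel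
  simp_rw [h3]
  have h4 : ∫ y, u ((1 - t) • x + y) * smoothingKernel η t (-y) =
      t ^ 2 * ∫ z, u ((1 - t) • x + t • z) * smoothingKernel η t (-(t • z)) := by
    rw [h1]
    simp only [finrank_euclideanSpace, Fintype.card_fin, smul_eq_mul]
    rw [abs_of_pos (by positivity), ← mul_assoc, mul_inv_cancel₀ (by positivity), one_mul]
  rw [h4, ← integral_const_mul]
  congr 1
  ext z
  rw [smoothingKernel, smul_neg, neg_neg, smul_smul, inv_mul_cancel₀ ht.ne', one_smul]
  field_simp
  rfl

theorem contDiff_smoothingKernel (hη : ContDiff ℝ ∞ η) : ContDiff ℝ ∞ (smoothingKernel η t) :=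
  contDiff_const.mul (hη.comp ((contDiff_const_smul _).neg))

theorem hasCompactSupport_smoothingKernel (hη : HasCompactSupport η) (ht : 0 < t) :
    HasCompactSupport (smoothingKernel η t) :=
  (hη.comp_homeomorph ((Homeomorph.smulOfNeZero t⁻¹ (inv_ne_zero ht.ne')).trans
    (Homeomorph.neg Plane))).mul_left

theorem locallyIntegrable_indicator (hΩ : MeasurableSet Ω) (hb : Bornology.IsBounded Ω)
    (hv : MemLp v 2 (volume.restrict Ω)) : LocallyIntegrable (Ω.indicator v) := by
  have := isFiniteMeasure_restrict hb
  exact ((integrable_indicator_iff hΩ).2 (hv.integrable one_le_two)).locallyIntegrable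

theorem contDiff_smoothing (hΩ : MeasurableSet Ω) (hb : Bornology.IsBounded Ω)
    (hv : MemLp v 2 (volume.restrict Ω)) (hη : ContDiff ℝ ∞ η) (hηc : HasCompactSupport η)
    (ht : 0 < t) : ContDiff ℝ ∞ (smoothing Ω η t v) := by
  have : smoothing Ω η t v = fun x =>
      (Ω.indicator v ⋆[ContinuousLinearMap.mul ℝ ℝ, volume] smoothingKernel η t)
        ((1 - t) • x) := funext fun x => smoothing_eq_convolution ht x
  rw [this]
  exact ((hasCompactSupport_smoothingKernel hηc ht).contDiff_convolution_right _
    (locallyIntegrable_indicator hΩ hb hv) (contDiff_smoothingKernel hη)).comp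
    (contDiff_const_smul _)

/-- The derivative falls on the kernel and is moved to `v` by the definition of the weak derivative;
the factor `1 - t` comes from the argument `(1 - t)x`. -/
theorem partialDeriv_smoothing (hΩ : IsOpen Ω) (hb : Bornology.IsBounded Ω) (hconv : Convex ℝ Ω)
    (hv : MemLp v 2 (volume.restrict Ω)) {i : Fin 2} (hw : HasWeakDeriv Ω i v w)
    (hη : ContDiff ℝ ∞ η) (hηc : HasCompactSupport η) (hηΩ : tsupport η ⊆ Ω)
    (ht : 0 < t) (ht1 : t < 1) {x : Plane} (hx : x ∈ Ω) :
    partialDeriv i (smoothing Ω η t v) x = (1 - t) * smoothing Ω η t w x := by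
  set k := smoothingKernel η t with hk
  have hkc : ContDiff ℝ ∞ k := contDiff_smoothingKernel hη
  have hkc1 : ContDiff ℝ 1 k := hkc.of_le (by exact_mod_cast le_top)
  have hks : HasCompactSupport k := hasCompactSupport_smoothingKernel hηc ht
  have hloc := locallyIntegrable_indicator hΩ.measurableSet hb hv
  set y := (1 - t) • x with hy
  have hd := hks.hasFDerivAt_convolution_right (ContinuousLinearMap.mul ℝ ℝ) hloc hkc1 y
  have e0 : smoothing Ω η t v = fun x =>
      (Ω.indicator v ⋆[ContinuousLinearMap.mul ℝ ℝ, volume] k) ((1 - t) • x) :=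
    funext fun x => smoothing_eq_convolution ht x
  have hd' : HasFDerivAt (smoothing Ω η t v) (((Ω.indicator v
      ⋆[(ContinuousLinearMap.mul ℝ ℝ).precompR Plane, volume] fderiv ℝ k) y).comp
        ((1 - t) • ContinuousLinearMap.id ℝ Plane)) x := by
    rw [e0]
    exact HasFDerivAt.comp x hd ((hasFDerivAt_id x).const_smul (1 - t))
  rw [partialDeriv, hd'.fderiv, smoothing_eq_convolution ht, ← hk, ← hy]
  simp only [ContinuousLinearMap.comp_apply, smul_apply,
    ContinuousLinearMap.id_apply, map_smul, smul_eq_mul]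
  congr 1
  rw [convolution_precompR_apply _ hloc (hks.fderiv ℝ) (hkc1.continuous_fderiv one_ne_zero)]
  simp only [convolution_def, ContinuousLinearMap.mul_apply']
  set ψ : Plane → ℝ := fun u => k (y - u) with hψ
  have hψc : ContDiff ℝ ∞ ψ := hkc.comp (contDiff_const.sub contDiff_id)
  have hψs : HasCompactSupport ψ := hks.comp_homeomorph (Homeomorph.subLeft y)
  -- The reflected kernel is an admissible test function: its support lies in `(1 - t)x + t supp η`,
  -- which convexity keeps inside `Ω`.
  have hψt : tsupport ψ ⊆ Ω := by
    have h1 : tsupport ψ ⊆ (fun u : Plane => -(t⁻¹ • (y - u))) ⁻¹' tsupport η := by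
      refine closure_minimal (fun u hu => subset_closure ?_)
        ((isClosed_tsupport η).preimage (by fun_prop))
      exact right_ne_zero_of_mul (Function.mem_support.1 hu)
    intro u hu
    have h2 := hconv hx (hηΩ (h1 hu)) (sub_pos.2 ht1).le ht.le (by ring)
    convert h2 using 1
    simp only [smul_neg, smul_smul, mul_inv_cancel₀ ht.ne', one_smul]
    rw [← hy]; abel
  have hψd : ∀ u, partialDeriv i ψ u = -(fderiv ℝ k (y - u) (EuclideanSpace.single i 1)) := by
    intro u
    have := ((hkc1.differentiable one_ne_zero (y - u)).hasFDerivAt).comp u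
      ((hasFDerivAt_const y u).sub (hasFDerivAt_id u))
    rw [partialDeriv, show ψ = k ∘ (fun u => y - u) from rfl]
    erw [this.fderiv]
    simp
  have key := hw.2 ψ hψc hψs hψt
  have r1 : ∀ f g : Plane → ℝ, ∫ u, Ω.indicator f u * g u = ∫ u in Ω, f u * g u := by
    intro f g
    rw [← integral_indicator hΩ.measurableSet]
    congr 1; ext u
    by_cases hu : u ∈ Ω <;> simp [hu]
  rw [r1, r1]
  simp_rw [hψd, mul_neg] at key
  rw [integral_neg] at key
  linarith

theorem smoothing_eq_integral_withDensity (hη : Continuous η) (hη0 : ∀ z, 0 ≤ η z) (x : Plane) :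
    smoothing Ω η t v x = ∫ z, Ω.indicator v ((1 - t) • x + t • z)
      ∂(volume.withDensity fun z => ENNReal.ofReal (η z)) := by
  rw [integral_withDensity_eq_integral_toReal_smul (by fun_prop) (by simp)]
  simp [smoothing, ENNReal.toReal_ofReal (hη0 _)]

theorem exists_contDiff_near (hΩ : IsOpen Ω) (hb : Bornology.IsBounded Ω) (hconv : Convex ℝ Ω)
    (hne : Ω.Nonempty) (hv : MemH1 Ω v) {δ : ℝ≥0∞} (hδ : δ ≠ 0) :
    ∃ φ : Plane → ℝ, ContDiff ℝ ∞ φ ∧ l2Norm Ω (fun x => φ x - v x) ≤ δ ∧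
      ∀ i, l2Norm Ω (fun x => partialDeriv i φ x - weakDeriv Ω i v x) ≤ δ := by
  obtain ⟨c, hc⟩ := hne
  obtain ⟨r, hr, hrΩ⟩ := Metric.isOpen_iff.1 hΩ c hc
  let f : ContDiffBump c := ⟨r / 4, r / 2, by positivity, by linarith⟩
  set η : Plane → ℝ := f.normed volume with hηdef
  have hη : ContDiff ℝ ∞ η := f.contDiff_normed
  have hηs : HasCompactSupport η := f.hasCompactSupport_normed
  have hη0 : ∀ z, 0 ≤ η z := f.nonneg_normed
  have hηΩ : tsupport η ⊆ Ω := by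
    rw [hηdef, f.tsupport_normed_eq]
    exact (Metric.closedBall_subset_ball (by change r / 2 < r; linarith)).trans hrΩ
  set ν : Measure Plane := volume.withDensity fun z => ENNReal.ofReal (η z) with hν
  have hνp : IsProbabilityMeasure ν := ⟨by
    rw [hν, withDensity_apply _ .univ, Measure.restrict_univ,
      ← ofReal_integral_eq_lintegral_ofReal f.integrable_normed (.of_forall hη0),
      f.integral_normed, ENNReal.ofReal_one]⟩
  have hνΩ : ∀ᵐ z ∂ν, z ∈ Ω := by
    rw [hν, ae_withDensity_iff hη.continuous.measurable.ennreal_ofReal]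
    refine .of_forall fun z hz => hηΩ (subset_closure ?_)
    intro h0
    simp [h0] at hz
  -- `smoothing` sees only the a.e. class of `u` on `Ω`, so a measurable representative may be used
  -- in the Tonelli argument.
  have key : ∀ u : Plane → ℝ, MemLp u 2 (volume.restrict Ω) → ∀ δ : ℝ≥0∞, δ ≠ 0 →
      ∃ t₀ > 0, ∀ t : ℝ, 0 < t → t ≤ t₀ → l2Norm Ω (fun x => smoothing Ω η t u x - u x) ≤ δ := by
    intro u hu δ hδ
    set u' : Plane → ℝ := hu.1.mk u
    have hu' : u =ᵐ[volume.restrict Ω] u' := hu.1.ae_eq_mk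
    have hum : Measurable u' := hu.1.stronglyMeasurable_mk.measurable
    have hu1 : u =ᵐ[volume.restrict Ω] Ω.indicator u' := by
      filter_upwards [hu', ae_restrict_mem hΩ.measurableSet] with x h1 h2
      simp [h2, h1]
    have hu2 : Ω.indicator u =ᵐ[volume] Ω.indicator u' := by
      have := (ae_restrict_iff' hΩ.measurableSet).1 hu'
      filter_upwards [this] with x hx
      by_cases h : x ∈ Ω <;> simp [h, hx]
    obtain ⟨t₀, h0, ht⟩ := exists_eLpNorm_contraction_sub_le hΩ.measurableSet hb hconv
      (hu.ae_eq hu1) (hum.indicator hΩ.measurableSet) hδ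
    refine ⟨t₀, h0, fun t ht0 htt => ?_⟩
    have h2 := l2Norm_average_sub_le ν hνΩ (hum.indicator hΩ.measurableSet) (ht t ht0.le htt)
    have h3 : ∀ x, smoothing Ω η t u x = smoothing Ω η t u' x := fun x => by
      rw [smoothing_eq_convolution ht0, smoothing_eq_convolution ht0]
      simp only [convolution_def]
      exact integral_congr_ae (by filter_upwards [hu2] with y hy; rw [hy])
    refine le_trans (le_of_eq ?_) h2
    refine eLpNorm_congr_ae ?_
    filter_upwards [hu1] with x hx
    rw [hx, h3, smoothing_eq_integral_withDensity hη.continuous hη0]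
  have hmem : ∀ i, MemLp (weakDeriv Ω i v) 2 (volume.restrict Ω) := hv.memLp_weakDeriv
  obtain ⟨t₁, h1, ht₁⟩ := key v hv.1 δ hδ
  -- With `u = ∂ᵢv`, the error in the derivative is `(1 - t)(smoothing u - u) - t u`; each term
  -- receives `δ/2`.
  have hδ2 : δ / 2 ≠ 0 := ENNReal.div_ne_zero.2 ⟨hδ, by simp⟩
  choose s hs hs' using fun i => key (weakDeriv Ω i v) (hmem i) (δ / 2) hδ2
  have hlim : ∀ i, ∀ᶠ t : ℝ in 𝓝[>] 0, ENNReal.ofReal t * l2Norm Ω (weakDeriv Ω i v) ≤ δ / 2 := by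
    intro i
    have : Tendsto (fun t : ℝ => ENNReal.ofReal t * l2Norm Ω (weakDeriv Ω i v)) (𝓝[>] 0)
        (𝓝 (ENNReal.ofReal 0 * l2Norm Ω (weakDeriv Ω i v))) :=
      ENNReal.Tendsto.mul_const ((ENNReal.continuous_ofReal.tendsto 0).mono_left
        nhdsWithin_le_nhds) (.inr (hmem i).2.ne)
    rw [ENNReal.ofReal_zero, zero_mul] at this
    exact this.eventually (ge_mem_nhds (pos_iff_ne_zero.2 hδ2))
  have hIoc : ∀ a > (0 : ℝ), ∀ᶠ t : ℝ in 𝓝[>] 0, 0 < t ∧ t ≤ a := fun a ha =>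
    Ioc_mem_nhdsGT ha
  obtain ⟨t, ⟨⟨htp, ht1⟩, ht2, htlt⟩, hts, htl⟩ := ((hIoc t₁ h1).and ((hIoc (1 / 2) (by norm_num)).and
    ((eventually_all.2 fun i => hIoc (s i) (hs i)).and (eventually_all.2 hlim)))
      |>.exists.imp fun t ht => (⟨⟨ht.1, ht.2.1⟩, ht.2.2⟩ :
      (((0 < t ∧ t ≤ t₁) ∧ (0 < t ∧ t ≤ 1 / 2)) ∧ (∀ i, 0 < t ∧ t ≤ s i) ∧
        ∀ i, ENNReal.ofReal t * l2Norm Ω (weakDeriv Ω i v) ≤ δ / 2)))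
  refine ⟨smoothing Ω η t v, contDiff_smoothing hΩ.measurableSet hb hv.1 hη hηs htp,
    ht₁ t htp ht1, fun i => ?_⟩
  set u := weakDeriv Ω i v
  have hsm : ContDiff ℝ ∞ (smoothing Ω η t u) :=
    contDiff_smoothing hΩ.measurableSet hb (hmem i) hη hηs htp
  calc l2Norm Ω (fun x => partialDeriv i (smoothing Ω η t v) x - u x)
      = eLpNorm ((1 - t) • (fun x => smoothing Ω η t u x - u x) - t • u) 2
          (volume.restrict Ω) := by
        refine eLpNorm_congr_ae ?_
        filter_upwards [ae_restrict_mem hΩ.measurableSet] with x hx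
        rw [partialDeriv_smoothing hΩ hb hconv hv.1 (hasWeakDeriv_weakDeriv (hv.2 i)) hη hηs hηΩ
          htp (by linarith) hx]
        simp only [Pi.sub_apply, Pi.smul_apply, smul_eq_mul]
        ring
    _ ≤ eLpNorm ((1 - t) • (fun x => smoothing Ω η t u x - u x)) 2 (volume.restrict Ω) +
          eLpNorm (t • u) 2 (volume.restrict Ω) :=
        eLpNorm_sub_le ((hsm.continuous.aestronglyMeasurable.sub (hmem i).1).const_smul _)
          ((hmem i).1.const_smul _) one_le_two
    _ ≤ δ / 2 + δ / 2 := by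
        rw [eLpNorm_const_smul, eLpNorm_const_smul]
        refine add_le_add ?_ ?_
        · calc _ ≤ 1 * eLpNorm (fun x => smoothing Ω η t u x - u x) 2 (volume.restrict Ω) := by
                gcongr
                rw [Real.enorm_eq_ofReal (by linarith)]
                exact ENNReal.ofReal_le_one.2 (by linarith)
            _ ≤ δ / 2 := by rw [one_mul]; exact hs' i t htp (hts i).2
        · rw [Real.enorm_eq_ofReal htp.le]; exact htl i
    _ = δ := ENNReal.add_halves δ

theorem exists_seq_contDiff (hΩ : IsOpen Ω) (hb : Bornology.IsBounded Ω) (hconv : Convex ℝ Ω)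
    (hne : Ω.Nonempty) (hv : MemH1 Ω v) :
    ∃ φ : ℕ → Plane → ℝ, (∀ n, ContDiff ℝ ∞ (φ n)) ∧
      Tendsto (fun n => l2Norm Ω (fun x => φ n x - v x)) atTop (𝓝 0) ∧
      ∀ i, Tendsto (fun n => l2Norm Ω (fun x => partialDeriv i (φ n) x - weakDeriv Ω i v x))
        atTop (𝓝 0) := by
  -- For `n = 0` the tolerance is `⊤`, which is nonzero and imposes nothing.
  choose φ h1 h2 h3 using fun n : ℕ => exists_contDiff_near hΩ hb hconv hne hv
    (δ := (n : ℝ≥0∞)⁻¹) (by simp)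
  exact ⟨φ, h1, tendsto_of_tendsto_of_tendsto_of_le_of_le tendsto_const_nhds
    ENNReal.tendsto_inv_nat_nhds_zero (fun _ => zero_le) h2, fun i =>
    tendsto_of_tendsto_of_tendsto_of_le_of_le tendsto_const_nhds
      ENNReal.tendsto_inv_nat_nhds_zero (fun _ => zero_le) (fun n => h3 n i)⟩

end Smoothing

/-! ### Convergence in `L²` -/

section Convergence

variable {α : Type*} [MeasurableSpace α] {μ : Measure α} {f g : α → ℝ} {F : ℕ → α → ℝ}

theorem lintegral_enorm_mul_le (hf : AEStronglyMeasurable f μ) (hg : AEStronglyMeasurable g μ) :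
    ∫⁻ x, ‖f x * g x‖ₑ ∂μ ≤ eLpNorm f 2 μ * eLpNorm g 2 μ := by
  have := eLpNorm_smul_le_mul_eLpNorm (p := 2) (q := 2) (r := 1) hg hf
  rwa [eLpNorm_one_eq_lintegral_enorm] at this

theorem enorm_integral_mul_le (hf : AEStronglyMeasurable f μ) (hg : AEStronglyMeasurable g μ) :
    ‖∫ x, f x * g x ∂μ‖ₑ ≤ eLpNorm f 2 μ * eLpNorm g 2 μ :=
  (enorm_integral_le_lintegral_enorm _).trans (lintegral_enorm_mul_le hf hg)

theorem tendsto_integral_mul_of_eLpNorm (hf : MemLp f 2 μ) (hg : MemLp g 2 μ)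
    (hF : ∀ n, MemLp (F n) 2 μ)
    (h : Tendsto (fun n => eLpNorm (fun x => F n x - f x) 2 μ) atTop (𝓝 0)) :
    Tendsto (fun n => ∫ x, F n x * g x ∂μ) atTop (𝓝 (∫ x, f x * g x ∂μ)) := by
  refine tendsto_integral_of_L1' _ (hf.1.mul hg.1)
    (.of_forall fun n => MemLp.integrable_mul (hF n) hg) ?_
  have h0 : Tendsto (fun n => eLpNorm (fun x => F n x - f x) 2 μ * eLpNorm g 2 μ) atTop (𝓝 0) := by
    simpa using ENNReal.Tendsto.mul_const h (.inr hg.2.ne)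
  refine tendsto_of_tendsto_of_tendsto_of_le_of_le tendsto_const_nhds h0 (fun _ => zero_le)
    fun n => ?_
  rw [eLpNorm_one_eq_lintegral_enorm]
  refine le_trans (le_of_eq ?_) (lintegral_enorm_mul_le ((hF n).1.sub hf.1) hg.1)
  congr 1
  ext x
  simp [sub_mul]

theorem tendsto_eLpNorm_two (hf : MemLp f 2 μ) (hF : ∀ n, AEStronglyMeasurable (F n) μ)
    (h : Tendsto (fun n => eLpNorm (fun x => F n x - f x) 2 μ) atTop (𝓝 0)) :
    Tendsto (fun n => eLpNorm (F n) 2 μ) atTop (𝓝 (eLpNorm f 2 μ)) := by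
  have h1 : Tendsto (fun n => eLpNorm f 2 μ - eLpNorm (fun x => F n x - f x) 2 μ) atTop
      (𝓝 (eLpNorm f 2 μ)) := by
    simpa using ENNReal.Tendsto.sub tendsto_const_nhds h (.inl hf.2.ne)
  have h2 : Tendsto (fun n => eLpNorm f 2 μ + eLpNorm (fun x => F n x - f x) 2 μ) atTop
      (𝓝 (eLpNorm f 2 μ)) := by
    simpa using tendsto_const_nhds.add h
  refine tendsto_of_tendsto_of_tendsto_of_le_of_le h1 h2 (fun n => ?_) fun n => ?_
  · rw [tsub_le_iff_right]
    have : f = F n - fun x => F n x - f x := by ext; simp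
    conv_lhs => rw [this]
    exact eLpNorm_sub_le (hF n) ((hF n).sub hf.1) one_le_two
  · have : F n = f + fun x => F n x - f x := by ext; simp
    conv_lhs => rw [this]
    exact eLpNorm_add_le hf.1 ((hF n).sub hf.1) one_le_two

end Convergence

/-! ### The Poincaré inequality on a bounded convex open set -/

section Poincare

variable {Ω : Set Plane} {v : Plane → ℝ}

theorem fderiv_apply_eq_sum (φ : Plane → ℝ) (x u : Plane) :
    fderiv ℝ φ x u = ∑ i, partialDeriv i φ x * u i := by
  have hu : u = ∑ i, u i • EuclideanSpace.single i (1 : ℝ) := by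
    ext j; fin_cases j <;> simp
  conv_lhs => rw [hu]
  simp [partialDeriv, mul_comm]

theorem enorm_fderiv_apply_sq_le (φ : Plane → ℝ) (x u : Plane) :
    ‖fderiv ℝ φ x u‖ₑ ^ 2 ≤ ‖u‖ₑ ^ 2 * ∑ i, ‖partialDeriv i φ x‖ₑ ^ 2 := by
  have e : ∀ a : ℝ, ‖a‖ₑ ^ 2 = ENNReal.ofReal (a ^ 2) := fun a => by
    rw [Real.enorm_eq_ofReal_abs, ← ENNReal.ofReal_pow (abs_nonneg _), sq_abs]
  have e' : ‖u‖ₑ ^ 2 = ENNReal.ofReal (u 0 ^ 2 + u 1 ^ 2) := by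
    rw [← enorm_norm u, e, EuclideanSpace.real_norm_sq_eq, Fin.sum_univ_two]
  rw [e', fderiv_apply_eq_sum, e]
  simp only [e, Fin.sum_univ_two]
  rw [← ENNReal.ofReal_add (by positivity) (by positivity), ← ENNReal.ofReal_mul (by positivity)]
  refine ENNReal.ofReal_le_ofReal ?_
  nlinarith [sq_nonneg (partialDeriv 0 φ x * u 1 - partialDeriv 1 φ x * u 0)]

/-- The fundamental theorem of calculus along the segment, Jensen on `[0, 1]` and Cauchy–Schwarz for
the directional derivative. -/
theorem enorm_sub_sq_le_lintegral {φ : Plane → ℝ} (hφ : ContDiff ℝ 1 φ) (x y : Plane) :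
    ‖φ y - φ x‖ₑ ^ 2 ≤ ‖y - x‖ₑ ^ 2 * ∫⁻ t in Set.Ioc (0 : ℝ) 1,
      ∑ i, ‖partialDeriv i φ ((1 - t) • x + t • y)‖ₑ ^ 2 := by
  have hline : ∀ t : ℝ, HasDerivAt (fun t : ℝ => (1 - t) • x + t • y) (y - x) t := fun t => by
    have h1 := (((hasDerivAt_id t).const_sub 1).smul_const x).add ((hasDerivAt_id t).smul_const y)
    rw [show y - x = (-1 : ℝ) • x + (1 : ℝ) • y by module]
    exact h1
  have hd : ∀ t : ℝ, HasDerivAt (fun t : ℝ => φ ((1 - t) • x + t • y))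
      (fderiv ℝ φ ((1 - t) • x + t • y) (y - x)) t := fun t =>
    (hφ.differentiable one_ne_zero _).hasFDerivAt.comp_hasDerivAt t (hline t)
  have hc : Continuous fun t : ℝ => fderiv ℝ φ ((1 - t) • x + t • y) (y - x) := by
    have := hφ.continuous_fderiv one_ne_zero
    exact (this.comp (by fun_prop)).clm_apply continuous_const
  have ftc := intervalIntegral.integral_eq_sub_of_hasDerivAt (a := 0) (b := 1)
    (fun t _ => hd t) (hc.intervalIntegrable _ _)
  simp only [sub_self, zero_smul, one_smul, zero_add, sub_zero, add_zero] at ftc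
  rw [← ftc, intervalIntegral.integral_of_le zero_le_one]
  have : IsProbabilityMeasure ((volume : Measure ℝ).restrict (Set.Ioc 0 1)) := ⟨by simp⟩
  have hj := enorm_integral_sub_sq_le ((volume : Measure ℝ).restrict (Set.Ioc 0 1))
    hc.aestronglyMeasurable 0
  simp only [sub_zero] at hj
  refine hj.trans ?_
  rw [← lintegral_const_mul' _ _ (by simp)]
  exact lintegral_mono fun t => enorm_fderiv_apply_sq_le φ _ _

/-- For `t ≤ 1/2` the map `x ↦ (1 - t)x + ty` is a contraction of rate `t` towards `y`; for `t ≥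
1/2` the roles of `x` and `y` are exchanged. Either way the inner integral costs a factor 4 and the
outer one a factor `|Ω|`. -/
theorem lintegral_lintegral_segment_le (hΩ : MeasurableSet Ω) (hconv : Convex ℝ Ω)
    {G : Plane → ℝ≥0∞} (hG : Measurable G) :
    ∫⁻ x in Ω, ∫⁻ y in Ω, ∫⁻ t in Set.Ioc (0 : ℝ) 1, G ((1 - t) • x + t • y) ≤
      4 * volume Ω * ∫⁻ x in Ω, G x := by
  have hconst : ∀ c : ℝ≥0∞, ∫⁻ _ in Ω, c = c * volume Ω := fun c => by simp
  calc ∫⁻ x in Ω, ∫⁻ y in Ω, ∫⁻ t in Set.Ioc (0 : ℝ) 1, G ((1 - t) • x + t • y)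
      = ∫⁻ x in Ω, ∫⁻ t in Set.Ioc (0 : ℝ) 1, ∫⁻ y in Ω, G ((1 - t) • x + t • y) := by
        refine lintegral_congr fun x => ?_
        exact lintegral_lintegral_swap (Measurable.aemeasurable (by fun_prop))
    _ = ∫⁻ t in Set.Ioc (0 : ℝ) 1, ∫⁻ x in Ω, ∫⁻ y in Ω, G ((1 - t) • x + t • y) := by
        refine lintegral_lintegral_swap (Measurable.aemeasurable ?_)
        exact Measurable.lintegral_prod_right'
          (f := fun p : (Plane × ℝ) × Plane => G ((1 - p.1.2) • p.1.1 + p.1.2 • p.2)) (by fun_prop)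
    _ ≤ ∫⁻ t in Set.Ioc (0 : ℝ) 1, 4 * volume Ω * ∫⁻ x in Ω, G x := by
        refine setLIntegral_mono measurable_const fun t ht => ?_
        rcases le_total t (1 / 2) with h | h
        · rw [lintegral_lintegral_swap (Measurable.aemeasurable (by fun_prop))]
          calc _ ≤ ∫⁻ y in Ω, 4 * ∫⁻ x in Ω, G x :=
                setLIntegral_mono measurable_const fun y hy =>
                  lintegral_contraction_le hΩ hconv hy ht.1.le h hG
            _ = _ := by rw [hconst]; ring
        · calc _ ≤ ∫⁻ y in Ω, 4 * ∫⁻ x in Ω, G x := by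
                refine setLIntegral_mono measurable_const fun x hx => ?_
                have := lintegral_contraction_le hΩ hconv hx (t := 1 - t) (by linarith [ht.2])
                  (by linarith) hG
                simp only [sub_sub_cancel] at this
                simpa only [add_comm] using this
            _ = _ := by rw [hconst]; ring
    _ = _ := by simp

/-- The deviation at `x` is the average over `y` of `φ x - φ y`; Jensen and the segment estimate
give `4d²`, and `|Ω|` cancels. The constant therefore depends on the diameter bound only, not on the
angles. -/
theorem l2Norm_sub_average_sq_le_of_contDiff (hΩ : MeasurableSet Ω) (hb : Bornology.IsBounded Ω)
    (hconv : Convex ℝ Ω) (h0 : volume Ω ≠ 0) {d : ℝ} (hd : ∀ x ∈ Ω, ∀ y ∈ Ω, ‖y - x‖ ≤ d)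
    {φ : Plane → ℝ} (hφ : ContDiff ℝ 1 φ) :
    l2Norm Ω (fun x => φ x - ⨍ y in Ω, φ y) ^ 2 ≤
      ENNReal.ofReal (2 * d) ^ 2 * ∑ i, l2Norm Ω (partialDeriv i φ) ^ 2 := by
  have hfin := isFiniteMeasure_restrict hb
  have htop : volume Ω ≠ ⊤ := hb.measure_lt_top.ne
  set ν : Measure Plane := (volume.restrict Ω Set.univ)⁻¹ • volume.restrict Ω with hν
  have hνp : IsProbabilityMeasure ν := ⟨by
    simp [hν, ENNReal.inv_mul_cancel h0 htop]⟩
  have hφm : Measurable φ := hφ.continuous.measurable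
  have hpm : ∀ i, Measurable (partialDeriv i φ) := fun i =>
    (continuous_partialDeriv hφ i).measurable
  have hd' : ∀ x ∈ Ω, ∀ y ∈ Ω, ‖y - x‖ₑ ≤ ENNReal.ofReal d := fun x hx y hy => by
    rw [← ofReal_norm]; exact ENNReal.ofReal_le_ofReal (hd x hx y hy)
  set G : Plane → ℝ≥0∞ := fun p => ∑ i, ‖partialDeriv i φ p‖ₑ ^ 2 with hG
  have hGm : Measurable G := by
    refine Finset.measurable_sum _ fun i _ => ?_
    have := hpm i
    fun_prop
  have hGi : ∫⁻ x in Ω, G x = ∑ i, l2Norm Ω (partialDeriv i φ) ^ 2 := by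
    rw [hG, lintegral_finsetSum _ (fun i _ => by have := hpm i; fun_prop)]
    simp_rw [l2Norm, eLpNorm_two_sq]
  rw [l2Norm, eLpNorm_two_sq, ← hGi]
  calc ∫⁻ x in Ω, ‖φ x - ⨍ y in Ω, φ y‖ₑ ^ 2
      ≤ ∫⁻ x in Ω, (volume Ω)⁻¹ * ∫⁻ y in Ω, ‖φ y - φ x‖ₑ ^ 2 := by
        refine lintegral_mono fun x => ?_
        have hj := enorm_integral_sub_sq_le ν hφ.continuous.aestronglyMeasurable (φ x)
        rw [← enorm_neg, neg_sub, average]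
        refine hj.trans (le_of_eq ?_)
        rw [hν, lintegral_smul_measure, Measure.restrict_apply_univ, smul_eq_mul]
    _ = (volume Ω)⁻¹ * ∫⁻ x in Ω, ∫⁻ y in Ω, ‖φ y - φ x‖ₑ ^ 2 :=
        lintegral_const_mul' _ _ (ENNReal.inv_ne_top.2 h0)
    _ ≤ (volume Ω)⁻¹ * ∫⁻ x in Ω, ∫⁻ y in Ω, ENNReal.ofReal d ^ 2 *
          ∫⁻ t in Set.Ioc (0 : ℝ) 1, G ((1 - t) • x + t • y) := by
        refine mul_le_mul_right ?_ _
        refine setLIntegral_mono' hΩ fun x hx => setLIntegral_mono' hΩ fun y hy => ?_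
        refine (enorm_sub_sq_le_lintegral hφ x y).trans ?_
        gcongr
        exact hd' x hx y hy
    _ = (volume Ω)⁻¹ * (ENNReal.ofReal d ^ 2 * ∫⁻ x in Ω, ∫⁻ y in Ω,
          ∫⁻ t in Set.Ioc (0 : ℝ) 1, G ((1 - t) • x + t • y)) := by
        congr 1
        simp_rw [lintegral_const_mul' _ _ (ENNReal.pow_ne_top ENNReal.ofReal_ne_top :
          ENNReal.ofReal d ^ 2 ≠ ⊤)]
    _ ≤ (volume Ω)⁻¹ * (ENNReal.ofReal d ^ 2 * (4 * volume Ω * ∫⁻ x in Ω, G x)) := by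
        gcongr
        exact lintegral_lintegral_segment_le hΩ hconv hGm
    _ = ((volume Ω)⁻¹ * volume Ω) * (ENNReal.ofReal (2 * d) ^ 2 * ∫⁻ x in Ω, G x) := by
        rw [ENNReal.ofReal_mul two_pos.le, ENNReal.ofReal_ofNat]
        ring
    _ = _ := by rw [ENNReal.inv_mul_cancel h0 htop, one_mul]

theorem h1Semi_sq (Ω : Set Plane) (v : Plane → ℝ) :
    h1Semi Ω v ^ 2 = ∑ i, l2Norm Ω (weakDeriv Ω i v) ^ 2 := by
  rw [h1Semi, ← ENNReal.rpow_natCast, ← ENNReal.rpow_mul]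
  norm_num

theorem l2Norm_sub_average_le (hΩ : IsOpen Ω) (hb : Bornology.IsBounded Ω)
    (hconv : Convex ℝ Ω) (hne : Ω.Nonempty) {d : ℝ} (hd : ∀ x ∈ Ω, ∀ y ∈ Ω, ‖y - x‖ ≤ d)
    (hv : MemH1 Ω v) :
    l2Norm Ω (fun x => v x - ⨍ y in Ω, v y) ≤ ENNReal.ofReal (2 * d) * h1Semi Ω v := by
  have hfin := isFiniteMeasure_restrict hb
  have h0 : volume Ω ≠ 0 := (hΩ.measure_pos _ hne).ne'
  obtain ⟨φ, hφ, hφv, hφd⟩ := exists_seq_contDiff hΩ hb hconv hne hv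
  have hφ1 : ∀ n, ContDiff ℝ 1 (φ n) := fun n => (hφ n).of_le (by exact_mod_cast le_top)
  have hL : ∀ n, MemLp (φ n) 2 (volume.restrict Ω) := fun n =>
    memLp_of_continuous hb hΩ.measurableSet (hφ n).continuous
  have hmean : Tendsto (fun n => ⨍ y in Ω, φ n y) atTop (𝓝 (⨍ y in Ω, v y)) := by
    have := tendsto_integral_mul_of_eLpNorm hv.1 (memLp_const 1) hL hφv
    simp only [mul_one] at this
    simp only [setAverage_eq]
    exact this.const_smul _
  have hlhs : Tendsto (fun n => l2Norm Ω (fun x => φ n x - ⨍ y in Ω, φ n y)) atTop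
      (𝓝 (l2Norm Ω (fun x => v x - ⨍ y in Ω, v y))) := by
    refine tendsto_eLpNorm_two (hv.1.sub (memLp_const _))
      (fun n => (hL n).1.sub aestronglyMeasurable_const) ?_
    have hc : Tendsto (fun n => eLpNorm (fun _ : Plane => (⨍ y in Ω, φ n y) - ⨍ y in Ω, v y) 2
        (volume.restrict Ω)) atTop (𝓝 0) := by
      have e : ∀ n, eLpNorm (fun _ : Plane => (⨍ y in Ω, φ n y) - ⨍ y in Ω, v y) 2
          (volume.restrict Ω) = ‖(⨍ y in Ω, φ n y) - ⨍ y in Ω, v y‖ₑ *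
            volume.restrict Ω Set.univ ^ (1 / (2 : ℝ≥0∞).toReal) := fun n =>
        eLpNorm_const' _ two_ne_zero ENNReal.ofNat_ne_top
      simp_rw [e]
      have h1 : Tendsto (fun n => ‖(⨍ y in Ω, φ n y) - ⨍ y in Ω, v y‖ₑ) atTop (𝓝 0) := by
        have := (hmean.sub_const (⨍ y in Ω, v y)).enorm
        simpa using this
      have h2 : volume.restrict Ω Set.univ ^ (1 / (2 : ℝ≥0∞).toReal) ≠ ⊤ :=
        ENNReal.rpow_ne_top_of_nonneg (by positivity) (measure_ne_top _ _)
      simpa using ENNReal.Tendsto.mul_const h1 (.inr h2)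
    have hsum := hφv.add hc
    rw [add_zero] at hsum
    refine tendsto_of_tendsto_of_tendsto_of_le_of_le tendsto_const_nhds hsum (fun _ => zero_le)
      fun n => ?_
    refine le_trans (le_of_eq ?_) (eLpNorm_sub_le ((hL n).1.sub hv.1.1) aestronglyMeasurable_const
      one_le_two)
    congr 1
    ext x
    simp only [Pi.sub_apply]
    ring
  have hrhs : Tendsto (fun n => ENNReal.ofReal (2 * d) ^ 2 *
      ∑ i, l2Norm Ω (partialDeriv i (φ n)) ^ 2) atTop
      (𝓝 (ENNReal.ofReal (2 * d) ^ 2 * ∑ i, l2Norm Ω (weakDeriv Ω i v) ^ 2)) := by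
    refine ENNReal.Tendsto.const_mul (tendsto_finsetSum _ fun i _ => ?_)
      (.inr (ENNReal.pow_ne_top ENNReal.ofReal_ne_top))
    exact ENNReal.Tendsto.pow (tendsto_eLpNorm_two (hv.memLp_weakDeriv i)
      (fun n => (continuous_partialDeriv (hφ1 n) i).aestronglyMeasurable) (hφd i))
  rw [← ENNReal.pow_le_pow_left_iff two_ne_zero, mul_pow, h1Semi_sq]
  exact le_of_tendsto_of_tendsto' (ENNReal.Tendsto.pow hlhs) hrhs fun n =>
    l2Norm_sub_average_sq_le_of_contDiff hΩ.measurableSet hb hconv h0 hd (hφ1 n)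

end Poincare

/-! ### Integration over a triangle along the rays from a vertex -/

section Triangle

theorem mem_convexHull_triple_iff {W P Q x : Plane} :
    x ∈ convexHull ℝ {W, P, Q} ↔ ∃ r ∈ Set.Icc (0 : ℝ) 1, ∃ s ∈ Set.Icc (0 : ℝ) 1,
      x = W + (r • (P - W) + (r * s) • (Q - P)) := by
  rw [convexHull_insert (Set.insert_nonempty _ _), convexHull_pair, mem_convexJoin]
  simp only [Set.mem_singleton_iff, exists_eq_left, segment_eq_image', Set.mem_image]
  constructor
  · rintro ⟨b, ⟨s, hs, rfl⟩, r, hr, rfl⟩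
    exact ⟨r, hr, s, hs, by module⟩
  · rintro ⟨r, hr, s, hs, rfl⟩
    exact ⟨_, ⟨s, hs, rfl⟩, r, hr, by module⟩

/-- The coordinates of the plane in the basis `u`, `q`. -/
theorem exists_continuousLinearEquiv {u q : Plane} (hdet : u 0 * q 1 - u 1 * q 0 ≠ 0) :
    ∃ e : (ℝ × ℝ) ≃L[ℝ] Plane, ∀ a b, e (a, b) = a • u + b • q := by
  let f : (ℝ × ℝ) →ₗ[ℝ] Plane :=
    (LinearMap.toSpanSingleton ℝ Plane u).coprod (LinearMap.toSpanSingleton ℝ Plane q)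
  have hf : ∀ a b, f (a, b) = a • u + b • q := fun a b => by simp [f]
  have hinj : Function.Injective f := by
    rw [injective_iff_map_eq_zero]
    rintro ⟨a, b⟩ h
    rw [hf] at h
    have h0 : a * u 0 + b * q 0 = 0 := by simpa using congrArg (fun y : Plane => y 0) h
    have h1 : a * u 1 + b * q 1 = 0 := by simpa using congrArg (fun y : Plane => y 1) h
    have ha : a * (u 0 * q 1 - u 1 * q 0) = 0 := by linear_combination q 1 * h0 - q 0 * h1
    have hb : b * (u 0 * q 1 - u 1 * q 0) = 0 := by linear_combination u 0 * h1 - u 1 * h0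
    ext
    · exact (mul_eq_zero.1 ha).resolve_right hdet
    · exact (mul_eq_zero.1 hb).resolve_right hdet
  let e := (f.linearEquivOfInjective hinj (by simp)).toContinuousLinearEquiv
  exact ⟨e, fun a b => hf a b⟩

/-- Fubini and the substitution `b = r s` in the inner variable, whose Jacobian is `r`. -/
theorem setIntegral_below_diagonal {g : ℝ × ℝ → ℝ} (hg : Continuous g) :
    ∫ p in {p : ℝ × ℝ | 0 ≤ p.2 ∧ p.2 ≤ p.1 ∧ p.1 ≤ 1}, g p =
      ∫ r in (0 : ℝ)..1, ∫ s in (0 : ℝ)..1, r * g (r, r * s) := by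
  set D := {p : ℝ × ℝ | 0 ≤ p.2 ∧ p.2 ≤ p.1 ∧ p.1 ≤ 1} with hD
  have hclosed : IsClosed D :=
    (isClosed_le continuous_const continuous_snd).inter
      ((isClosed_le continuous_snd continuous_fst).inter
        (isClosed_le continuous_fst continuous_const))
  have hcomp : IsCompact D := by
    refine (isCompact_Icc.prod isCompact_Icc : IsCompact (Set.Icc (0 : ℝ) 1 ×ˢ Set.Icc (0 : ℝ) 1)
      ).of_isClosed_subset hclosed ?_
    rintro ⟨a, b⟩ ⟨h1, h2, h3⟩
    exact ⟨⟨h1.trans h2, h3⟩, h1, h2.trans h3⟩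
  have hint : Integrable (D.indicator g) (volume : Measure (ℝ × ℝ)) :=
    (integrable_indicator_iff hclosed.measurableSet).2 (hg.continuousOn.integrableOn_compact hcomp)
  rw [← integral_indicator hclosed.measurableSet, Measure.volume_eq_prod, integral_prod _ hint,
    intervalIntegral.integral_of_le zero_le_one, ← integral_Icc_eq_integral_Ioc,
    ← integral_indicator measurableSet_Icc]
  congr 1
  ext a
  by_cases ha : a ∈ Set.Icc (0 : ℝ) 1
  · rw [Set.indicator_of_mem ha]
    have h1 : ∀ b, D.indicator g (a, b) = (Set.Icc 0 a).indicator (fun b => g (a, b)) b := by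
      intro b
      by_cases hb : b ∈ Set.Icc 0 a
      · rw [Set.indicator_of_mem hb, Set.indicator_of_mem (show (a, b) ∈ D from
          ⟨hb.1, hb.2, ha.2⟩)]
      · rw [Set.indicator_of_notMem hb, Set.indicator_of_notMem (fun h : (a, b) ∈ D =>
          hb ⟨h.1, h.2.1⟩)]
    simp_rw [h1]
    rw [integral_indicator measurableSet_Icc, integral_Icc_eq_integral_Ioc,
      ← intervalIntegral.integral_of_le ha.1, intervalIntegral.integral_const_mul]
    have := intervalIntegral.smul_integral_comp_mul_left (a := 0) (b := 1)
      (f := fun b => g (a, b)) a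
    simpa using this.symm
  · rw [Set.indicator_of_notMem ha]
    have h1 : ∀ b, D.indicator g (a, b) = 0 := fun b =>
      Set.indicator_of_notMem (fun h : (a, b) ∈ D => ha ⟨h.1.trans h.2.1, h.2.2⟩) _
    simp [h1]

variable {W P Q : Plane}

/-- Integration along the rays from `W` to the points of `PQ`. The constant comes from uniqueness of
Haar measure and is not computed: testing with a constant function later identifies it with `2|T|`.
-/
theorem exists_setIntegral_triangle_eq
    (hdet : (P - W) 0 * (Q - P) 1 - (P - W) 1 * (Q - P) 0 ≠ 0) :
    ∃ c : ℝ, 0 < c ∧ ∀ f : Plane → ℝ, Continuous f →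
      ∫ x in interior (convexHull ℝ {W, P, Q}), f x =
        c * ∫ r in (0 : ℝ)..1, ∫ s in (0 : ℝ)..1,
          r * f (W + (r • (P - W) + (r * s) • (Q - P))) := by
  obtain ⟨e, he⟩ := exists_continuousLinearEquiv hdet
  set c := Measure.addHaarScalarFactor (volume : Measure Plane)
    ((volume : Measure (ℝ × ℝ)).map e)
  have hc : (volume : Measure Plane) = c • ((volume : Measure (ℝ × ℝ)).map e) :=
    Measure.isAddLeftInvariant_eq_smul ..
  refine ⟨c, NNReal.coe_pos.2 (Measure.addHaarScalarFactor_pos_of_isAddHaarMeasure ..),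
    fun f hf => ?_⟩
  set K := convexHull ℝ {W, P, Q} with hK
  have hKc : Convex ℝ K := convex_convexHull _ _
  have hKm : MeasurableSet K :=
    ((Set.toFinite {W, P, Q}).isCompact_convexHull (𝕜 := ℝ)).isClosed.measurableSet
  let E : ℝ × ℝ → Plane := fun p => W + e p
  have hEe : MeasurableEmbedding E :=
    (e.toHomeomorph.trans (Homeomorph.addLeft W)).measurableEmbedding
  have hEc : Continuous E := continuous_const.add e.continuous
  have hE : (volume : Measure Plane) = c • ((volume : Measure (ℝ × ℝ)).map E) := by
    have h1 : (volume : Measure (ℝ × ℝ)).map E =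
        ((volume : Measure (ℝ × ℝ)).map e).map (fun y => W + y) := by
      rw [Measure.map_map (by fun_prop) e.continuous.measurable]; rfl
    rw [h1, ← Measure.map_smul, ← hc, map_add_left_eq_self]
  have hpre : E ⁻¹' K = {p : ℝ × ℝ | 0 ≤ p.2 ∧ p.2 ≤ p.1 ∧ p.1 ≤ 1} := by
    ext ⟨a, b⟩
    simp only [Set.mem_preimage, hK, mem_convexHull_triple_iff, Set.mem_ofPred_eq, E]
    constructor
    · rintro ⟨r, hr, s, hs, h⟩
      rw [← he, add_right_inj, e.injective.eq_iff, Prod.mk.injEq] at h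
      obtain ⟨rfl, rfl⟩ := h
      exact ⟨mul_nonneg hr.1 hs.1, mul_le_of_le_one_right hr.1 hs.2, hr.2⟩
    · rintro ⟨h1, h2, h3⟩
      refine ⟨a, ⟨h1.trans h2, h3⟩, b / a, ⟨div_nonneg h1 (h1.trans h2),
        div_le_one_of_le₀ h2 (h1.trans h2)⟩, ?_⟩
      -- The vertex `W` is the case `a = b = 0`, where `b / a` takes the default value 0.
      rcases eq_or_ne a 0 with rfl | ha
      · obtain rfl : b = 0 := le_antisymm h2 h1
        simp [he]
      · rw [he, mul_div_cancel₀ _ ha]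
  calc ∫ x in interior K, f x = ∫ x in K, f x :=
        setIntegral_congr_set (interior_ae_eq_of_null_frontier (hKc.addHaar_frontier _))
    _ = c * ∫ p in E ⁻¹' K, f (E p) := by
        rw [← hEe.setIntegral_map]
        conv_lhs => rw [hE]
        rw [Measure.restrict_smul, integral_smul_nnreal_measure, NNReal.smul_def, smul_eq_mul]
    _ = _ := by
        rw [hpre, setIntegral_below_diagonal (g := fun p => f (E p)) (hf.comp hEc)]
        simp only [E, he]

theorem volume_real_triangle_pos
    (hdet : (P - W) 0 * (Q - P) 1 - (P - W) 1 * (Q - P) 0 ≠ 0) :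
    0 < volume.real (interior (convexHull ℝ {W, P, Q})) := by
  obtain ⟨c, hc0, hc⟩ := exists_setIntegral_triangle_eq hdet
  have h1 := hc (fun _ => 1) continuous_const
  simp only [mul_one, intervalIntegral.integral_const, setIntegral_const, smul_eq_mul, sub_zero,
    integral_id, one_mul] at h1
  rw [h1]
  positivity

/-- The integral over a triangle of `div ((x - W) φ)`, for a vertex `W`. -/
theorem setIntegral_triangle_div
    (hdet : (P - W) 0 * (Q - P) 1 - (P - W) 1 * (Q - P) 0 ≠ 0) {φ : Plane → ℝ}
    (hφ : ContDiff ℝ 1 φ) :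
    ∫ x in interior (convexHull ℝ {W, P, Q}), (2 * φ x + fderiv ℝ φ x (x - W)) =
      2 * volume.real (interior (convexHull ℝ {W, P, Q})) *
        ∫ s in (0 : ℝ)..1, φ (AffineMap.lineMap P Q s) := by
  obtain ⟨c, -, hc⟩ := exists_setIntegral_triangle_eq hdet
  have key : ∀ φ : Plane → ℝ, ContDiff ℝ 1 φ →
      ∫ x in interior (convexHull ℝ {W, P, Q}), (2 * φ x + fderiv ℝ φ x (x - W)) =
        c * ∫ s in (0 : ℝ)..1, φ (AffineMap.lineMap P Q s) := by
    intro φ hφ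
    have hdc := hφ.continuous_fderiv one_ne_zero
    have hfc : Continuous fun x => 2 * φ x + fderiv ℝ φ x (x - W) :=
      (continuous_const.mul hφ.continuous).add (hdc.clm_apply (by fun_prop))
    rw [hc _ hfc]
    congr 1
    rw [intervalIntegral_intervalIntegral_swap]
    · congr 1
      ext s
      set y := (P - W) + s • (Q - P) with hy
      have hx : ∀ r : ℝ, W + (r • (P - W) + (r * s) • (Q - P)) = W + r • y := fun r => by
        rw [hy]; module
      simp only [hx]
      have hline : ∀ r : ℝ, HasDerivAt (fun r : ℝ => W + r • y) y r := fun r => by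
        simpa using ((hasDerivAt_id r).smul_const y).const_add W
      -- Along a ray the integrand is the derivative of `r² φ`, so only the end `r = 1` on the
      -- opposite edge contributes.
      have hd : ∀ r : ℝ, HasDerivAt (fun r : ℝ => r ^ 2 * φ (W + r • y))
          (r * (2 * φ (W + r • y) + fderiv ℝ φ (W + r • y) (W + r • y - W))) r := fun r => by
        have h1 := (hφ.differentiable one_ne_zero (W + r • y)).hasFDerivAt.comp_hasDerivAt r
          (hline r)
        have h2 := (hasDerivAt_pow 2 r).mul h1
        refine h2.congr_deriv ?_
        simp only [add_sub_cancel_left, map_smul, smul_eq_mul, Function.comp_apply]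
        push_cast
        ring
      rw [intervalIntegral.integral_eq_sub_of_hasDerivAt (fun r _ => hd r)
        (Continuous.intervalIntegrable (by fun_prop) _ _)]
      simp only [one_pow, one_smul, one_mul, ne_eq, OfNat.ofNat_ne_zero, not_false_eq_true,
        zero_pow, zero_mul, sub_zero]
      congr 1
      rw [AffineMap.lineMap_apply_module', hy]
      abel
    · refine (ContinuousOn.integrableOn_compact (K := Set.Icc (0 : ℝ) 1 ×ˢ Set.Icc (0 : ℝ) 1)
        (isCompact_Icc.prod isCompact_Icc) ?_).mono_set ?_
      · exact (continuous_fst.mul (hfc.comp (by fun_prop))).continuousOn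
      · simp only [Set.uIoc_of_le zero_le_one]
        exact Set.prod_mono Set.Ioc_subset_Icc_self Set.Ioc_subset_Icc_self
  -- Taking `φ = 1` shows `c = 2|T|`.
  have h1 := key (fun _ => 1) contDiff_const
  simp at h1
  rw [key φ hφ]
  congr 1
  rw [← h1]
  ring

end Triangle

/-! ### The triangle `T_{α,θ,h}` -/

section Geometry

variable {α θ h : ℝ}

/-- The vertices opposite to the edges `e₁`, `e₂`, `e₃`. -/
noncomputable def oppVertex (α θ h : ℝ) : Fin 3 → Plane :=
  ![vertexB α θ h, vertexA h, vertexO]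

theorem ShapeRange.sin_pos (hs : ShapeRange α θ) : 0 < Real.sin θ := by
  obtain ⟨h1, h2, h3, h4⟩ := hs
  refine Real.sin_pos_of_pos_of_lt_pi (lt_of_lt_of_le ?_ h3) h4
  exact Real.arccos_pos.2 (by linarith)

theorem tri_eq (α θ h : ℝ) (i : Fin 3) : tri α θ h =
    interior (convexHull ℝ {oppVertex α θ h i, edgeStart h i, edgeEnd α θ h i}) := by
  rw [tri]
  congr 2
  fin_cases i <;> ext x <;> simp [oppVertex, edgeStart, edgeEnd] <;> tauto

/-- For each choice of the vertex, this is up to sign twice the area, `α h² sin θ`. -/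
theorem det_edge_ne_zero (hs : ShapeRange α θ) (hh : 0 < h) (i : Fin 3) :
    (edgeStart h i - oppVertex α θ h i) 0 * (edgeEnd α θ h i - edgeStart h i) 1 -
      (edgeStart h i - oppVertex α θ h i) 1 * (edgeEnd α θ h i - edgeStart h i) 0 ≠ 0 := by
  have hp : α * h * Real.sin θ * h ≠ 0 := (mul_pos (mul_pos (mul_pos hs.1 hh) hs.sin_pos) hh).ne'
  fin_cases i
  · convert hp using 1
    simp [oppVertex, edgeStart, edgeEnd, vertexO, vertexA, vertexB]
  · convert neg_ne_zero.2 hp using 1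
    simp [oppVertex, edgeStart, edgeEnd, vertexO, vertexA, vertexB]
    ring
  · convert hp using 1
    simp [oppVertex, edgeStart, edgeEnd, vertexO, vertexA, vertexB]
    ring

theorem isOpen_tri : IsOpen (tri α θ h) := isOpen_interior

theorem convex_tri : Convex ℝ (tri α θ h) := (convex_convexHull _ _).interior

theorem isBounded_tri : Bornology.IsBounded (tri α θ h) :=
  (isBounded_convexHull.2 (Set.toFinite _).isBounded).subset interior_subset

theorem volume_real_tri_pos (hs : ShapeRange α θ) (hh : 0 < h) :
    0 < volume.real (tri α θ h) := by
  rw [tri_eq α θ h 0]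
  exact volume_real_triangle_pos (det_edge_ne_zero hs hh 0)

theorem nonempty_tri (hs : ShapeRange α θ) (hh : 0 < h) : (tri α θ h).Nonempty := by
  by_contra hne
  have := volume_real_tri_pos hs hh
  simp [Set.not_nonempty_iff_eq_empty.1 hne] at this

/-- Because `α ≤ 1`, the triangle lies in the ball of radius `h` about `O` for every `θ`. All bounds
uniform in the shape rest on this. -/
theorem vertex_norm_le (hs : ShapeRange α θ) (hh : 0 < h) :
    ‖vertexO‖ ≤ h ∧ ‖vertexA h‖ ≤ h ∧ ‖vertexB α θ h‖ ≤ h := by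
  have e : ∀ x : Plane, x 0 ^ 2 + x 1 ^ 2 ≤ h ^ 2 → ‖x‖ ≤ h := fun x hx => by
    rw [← pow_le_pow_iff_left₀ (norm_nonneg _) hh.le two_ne_zero, EuclideanSpace.real_norm_sq_eq,
      Fin.sum_univ_two]
    exact hx
  refine ⟨e _ ?_, e _ ?_, e _ ?_⟩
  · simp [vertexO]; positivity
  · simp [vertexA]
  · have h1 : α ^ 2 ≤ 1 := by nlinarith [hs.1, hs.2.1]
    have h2 : (α * h * Real.cos θ) ^ 2 + (α * h * Real.sin θ) ^ 2 = α ^ 2 * h ^ 2 := by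
      linear_combination (α * h) ^ 2 * Real.sin_sq_add_cos_sq θ
    simp only [vertexB, PiLp.toLp_apply, Matrix.cons_val_zero, Matrix.cons_val_one]
    rw [h2]
    nlinarith [sq_nonneg h]

theorem tri_subset_closedBall (hs : ShapeRange α θ) (hh : 0 < h) :
    tri α θ h ⊆ Metric.closedBall 0 h := by
  obtain ⟨h1, h2, h3⟩ := vertex_norm_le hs hh
  refine interior_subset.trans (convexHull_min ?_ (convex_closedBall _ _))
  rintro x (rfl | rfl | rfl) <;> simpa

theorem norm_oppVertex_le (hs : ShapeRange α θ) (hh : 0 < h) (i : Fin 3) :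
    ‖oppVertex α θ h i‖ ≤ h := by
  obtain ⟨h1, h2, h3⟩ := vertex_norm_le hs hh
  fin_cases i <;> assumption

/-- The open edges are disjoint and injectively parametrized, so three functions given on the
parameter intervals glue to one function on the plane. -/
theorem edgePath_inj (hs : ShapeRange α θ) (hh : 0 < h) {i j : Fin 3} {s t : ℝ}
    (hs' : s ∈ Set.Ioo (0 : ℝ) 1) (ht : t ∈ Set.Ioo (0 : ℝ) 1)
    (he : edgePath α θ h i s = edgePath α θ h j t) : i = j ∧ s = t := by
  obtain ⟨s0, s1⟩ := hs'
  obtain ⟨t0, t1⟩ := ht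
  have h0 := congrArg (fun y : Plane => y 0) he
  have h1 := congrArg (fun y : Plane => y 1) he
  simp only [edgePath, AffineMap.lineMap_apply_module] at h0 h1
  have hs1 : 0 < (1 - s) * h := mul_pos (by linarith) hh
  have ht1 : 0 < (1 - t) * h := mul_pos (by linarith) hh
  fin_cases i <;> fin_cases j <;>
    simp [edgeStart, edgeEnd, vertexO, vertexA, vertexB, hs.1.ne', hh.ne', hs.sin_pos.ne', s0.ne',
      t0.ne'] at h0 h1 ⊢
  · exact h0
  · exact h1
  · rw [h1] at h0; linarith
  · rw [h1] at h0; linarith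
  · exact h1

end Geometry

/-! ### Traces -/

section Trace

variable {α θ h : ℝ} {v : Plane → ℝ}

theorem continuous_edgePath (α θ h : ℝ) (i : Fin 3) : Continuous (edgePath α θ h i) :=
  AffineMap.lineMap_continuous

theorem eLpNorm_two_sq_eq_ofReal {β : Type*} [MeasurableSpace β] {μ : Measure β} {f : β → ℝ}
    (hf : MemLp f 2 μ) : eLpNorm f 2 μ ^ 2 = ENNReal.ofReal (∫ x, f x ^ 2 ∂μ) := by
  rw [eLpNorm_two_sq, ofReal_integral_eq_lintegral_ofReal hf.integrable_sq
    (.of_forall fun x => sq_nonneg _)]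
  congr 1
  ext x
  rw [Real.enorm_eq_ofReal_abs, ← ENNReal.ofReal_pow (abs_nonneg _), sq_abs]

theorem setIntegral_tri_div (hs : ShapeRange α θ) (hh : 0 < h) (i : Fin 3) {φ : Plane → ℝ}
    (hφ : ContDiff ℝ 1 φ) :
    ∫ x in tri α θ h, (2 * φ x + fderiv ℝ φ x (x - oppVertex α θ h i)) =
      2 * volume.real (tri α θ h) * ∫ s in (0 : ℝ)..1, φ (edgePath α θ h i s) := by
  rw [tri_eq α θ h i]
  exact setIntegral_triangle_div (det_edge_ne_zero hs hh i) hφ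

/-- The divergence identity applied to `φ²`, with `2φ (x - W)·∇φ ≤ φ² + |x - W|²|∇φ|²` and `|x - W|
≤ 2h`. -/
theorem integral_edge_sq_le (hs : ShapeRange α θ) (hh : 0 < h) (i : Fin 3) {φ : Plane → ℝ}
    (hφ : ContDiff ℝ 1 φ) :
    2 * volume.real (tri α θ h) * ∫ s in (0 : ℝ)..1, φ (edgePath α θ h i s) ^ 2 ≤
      (3 + (2 * h) ^ 2) *
        ((∫ x in tri α θ h, φ x ^ 2) + ∑ k, ∫ x in tri α θ h, partialDeriv k φ x ^ 2) := by
  have hφc := hφ.continuous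
  have hpc : ∀ k, Continuous (partialDeriv k φ) := continuous_partialDeriv hφ
  have hi : ∀ {f : Plane → ℝ}, Continuous f → Integrable f (volume.restrict (tri α θ h)) :=
    fun hf => memLp_one_iff_integrable.1
      (memLp_of_continuous isBounded_tri isOpen_tri.measurableSet hf)
  rw [← setIntegral_tri_div hs hh i (hφ.pow 2)]
  have hsum : (∫ x in tri α θ h, φ x ^ 2) + ∑ k, ∫ x in tri α θ h, partialDeriv k φ x ^ 2 =
      ∫ x in tri α θ h, (φ x ^ 2 + ∑ k, partialDeriv k φ x ^ 2) := by
    have i1 : Integrable (fun x => φ x ^ 2) (volume.restrict (tri α θ h)) := hi (hφc.pow 2)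
    have i2 : ∀ k, Integrable (fun x => partialDeriv k φ x ^ 2) (volume.restrict (tri α θ h)) :=
      fun k => hi ((hpc k).pow 2)
    rw [integral_add i1 (integrable_finsetSum _ fun k _ => i2 k),
      integral_finsetSum _ (fun k _ => i2 k)]
  rw [hsum, ← integral_const_mul]
  have hfd : ∀ x u, fderiv ℝ (fun x => φ x ^ 2) x u = 2 * φ x * fderiv ℝ φ x u := fun x u => by
    rw [fderiv_fun_pow 2 (hφ.differentiable one_ne_zero x)]
    simp
  refine setIntegral_mono_on (hi ?_) (hi ?_) isOpen_tri.measurableSet fun x hx => ?_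
  · exact (continuous_const.mul (hφc.pow 2)).add
      (((hφ.pow 2).continuous_fderiv one_ne_zero).clm_apply (by fun_prop))
  · exact continuous_const.mul
      ((hφc.pow 2).add (continuous_finsetSum _ fun k _ => (hpc k).pow 2))
  · rw [hfd, fderiv_apply_eq_sum]
    set u := x - oppVertex α θ h i with hu
    have hun : ‖u‖ ≤ 2 * h := by
      have h1 := norm_sub_le x (oppVertex α θ h i)
      have h2 := norm_oppVertex_le hs hh i
      have h3 : ‖x‖ ≤ h := by simpa using tri_subset_closedBall hs hh hx
      linarith
    have hun2 : u 0 ^ 2 + u 1 ^ 2 ≤ (2 * h) ^ 2 := by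
      have := pow_le_pow_left₀ (norm_nonneg u) hun 2
      rwa [EuclideanSpace.real_norm_sq_eq, Fin.sum_univ_two] at this
    simp only [Fin.sum_univ_two]
    set a := partialDeriv 0 φ x
    set b := partialDeriv 1 φ x
    set p := φ x
    have h1 : (a * u 0 + b * u 1) ^ 2 ≤ (u 0 ^ 2 + u 1 ^ 2) * (a ^ 2 + b ^ 2) := by
      nlinarith [sq_nonneg (a * u 1 - b * u 0)]
    have h2 : (u 0 ^ 2 + u 1 ^ 2) * (a ^ 2 + b ^ 2) ≤ (2 * h) ^ 2 * (a ^ 2 + b ^ 2) := by gcongr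
    nlinarith [sq_nonneg (p - (a * u 0 + b * u 1)), sq_nonneg a, sq_nonneg b,
      mul_nonneg (sq_nonneg (2 * h)) (sq_nonneg p)]

theorem memLp_edge {φ : Plane → ℝ} (hφ : Continuous φ) (i : Fin 3) :
    MemLp (fun t => φ (edgePath α θ h i t)) 2 (volume.restrict (Set.Icc (0 : ℝ) 1)) := by
  have hc : Continuous fun t => φ (edgePath α θ h i t) := hφ.comp (continuous_edgePath α θ h i)
  obtain ⟨C, hC⟩ := isCompact_Icc.exists_bound_of_continuousOn (s := Set.Icc (0 : ℝ) 1)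
    hc.continuousOn
  exact MemLp.of_bound hc.aestronglyMeasurable C
    ((ae_restrict_iff' measurableSet_Icc).2 (.of_forall hC))

/-- The constant blows up as the area tends to 0. This is harmless: it serves only to construct
traces and enters no final estimate. -/
theorem exists_trace_inequality (hs : ShapeRange α θ) (hh : 0 < h) (i : Fin 3) :
    ∃ C : ℝ≥0, ∀ φ : Plane → ℝ, ContDiff ℝ 1 φ →
      eLpNorm (fun t => φ (edgePath α θ h i t)) 2 (volume.restrict (Set.Icc (0 : ℝ) 1)) ≤
        C * (l2Norm (tri α θ h) φ + ∑ k, l2Norm (tri α θ h) (partialDeriv k φ)) := by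
  have hV := volume_real_tri_pos hs hh
  set V := volume.real (tri α θ h)
  set c : ℝ := (3 + (2 * h) ^ 2) / (2 * V) with hc
  have hc0 : 0 ≤ c := by positivity
  refine ⟨NNReal.sqrt c.toNNReal, fun φ hφ => ?_⟩
  have hpc : ∀ k, Continuous (partialDeriv k φ) := continuous_partialDeriv hφ
  have hL : ∀ {f : Plane → ℝ}, Continuous f → MemLp f 2 (volume.restrict (tri α θ h)) :=
    fun hf => memLp_of_continuous isBounded_tri isOpen_tri.measurableSet hf
  have hC : (NNReal.sqrt c.toNNReal : ℝ≥0∞) ^ 2 = ENNReal.ofReal c := by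
    rw [← ENNReal.coe_pow, NNReal.sq_sqrt]
    rfl
  have hR := integral_edge_sq_le hs hh i hφ
  rw [← ENNReal.pow_le_pow_left_iff two_ne_zero, mul_pow, hC,
    eLpNorm_two_sq_eq_ofReal (memLp_edge hφ.continuous i), integral_Icc_eq_integral_Ioc,
    ← intervalIntegral.integral_of_le zero_le_one]
  calc _ ≤ ENNReal.ofReal (c * ((∫ x in tri α θ h, φ x ^ 2) +
          ∑ k, ∫ x in tri α θ h, partialDeriv k φ x ^ 2)) := by
        refine ENNReal.ofReal_le_ofReal ?_
        rw [hc, div_mul_eq_mul_div, le_div_iff₀ (by positivity)]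
        linarith
    _ = ENNReal.ofReal c * (l2Norm (tri α θ h) φ ^ 2 +
          ∑ k, l2Norm (tri α θ h) (partialDeriv k φ) ^ 2) := by
        have hn : ∀ f : Plane → ℝ, 0 ≤ ∫ x in tri α θ h, f x ^ 2 := fun f =>
          integral_nonneg fun x => sq_nonneg _
        rw [ENNReal.ofReal_mul hc0, ENNReal.ofReal_add (hn _)
          (Finset.sum_nonneg fun k _ => hn _), ENNReal.ofReal_sum_of_nonneg fun k _ => hn _]
        simp only [l2Norm, eLpNorm_two_sq_eq_ofReal (hL hφ.continuous),
          eLpNorm_two_sq_eq_ofReal (hL (hpc _))]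
    _ ≤ _ := by
        refine mul_le_mul_right ?_ _
        simp only [Fin.sum_univ_two]
        set A := l2Norm (tri α θ h) φ
        set B := l2Norm (tri α θ h) (partialDeriv 0 φ)
        set D := l2Norm (tri α θ h) (partialDeriv 1 φ)
        calc A ^ 2 + (B ^ 2 + D ^ 2)
            ≤ A ^ 2 + (B ^ 2 + D ^ 2) + (2 * A * B + 2 * A * D + 2 * B * D) := le_self_add
          _ = _ := by ring

/-- By the trace inequality the restrictions of smooth approximations are Cauchy in `L²` of each
edge; completeness gives the limits. Without this lemma `bdryTrace` could be its default value 0. -/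
theorem exists_isTrace (hs : ShapeRange α θ) (hh : 0 < h) (hv : MemH1 (tri α θ h) v) :
    ∃ g, IsTrace α θ h v g := by
  obtain ⟨φ, hφ, hφv, hφd⟩ := exists_seq_contDiff isOpen_tri isBounded_tri convex_tri
    (nonempty_tri hs hh) hv
  have hφ1 : ∀ n, ContDiff ℝ 1 (φ n) := fun n => (hφ n).of_le (by exact_mod_cast le_top)
  set T := tri α θ h
  have lim : ∀ i, ∃ G : ℝ → ℝ, MemLp G 2 (volume.restrict (Set.Icc (0 : ℝ) 1)) ∧
      Tendsto (fun n => eLpNorm (fun t => φ n (edgePath α θ h i t) - G t) 2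
        (volume.restrict (Set.Icc (0 : ℝ) 1))) atTop (𝓝 0) := by
    intro i
    obtain ⟨C, hC⟩ := exists_trace_inequality hs hh i
    have hmem : ∀ n, MemLp (fun t => φ n (edgePath α θ h i t)) 2
      (volume.restrict (Set.Icc (0 : ℝ) 1)) := fun n => memLp_edge (hφ n).continuous i
    set a : ℕ → ℝ≥0∞ := fun n => C * (l2Norm T (fun x => φ n x - v x) +
      ∑ k, l2Norm T (fun x => partialDeriv k (φ n) x - weakDeriv T k v x)) with ha
    have ha0 : Tendsto a atTop (𝓝 0) := by
      have := ENNReal.Tendsto.const_mul (a := (C : ℝ≥0∞)) (hφv.add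
        (tendsto_finsetSum Finset.univ fun k _ => hφd k)) (.inr ENNReal.coe_ne_top)
      simpa [ha] using this
    have tri_ineq : ∀ (f : ℕ → Plane → ℝ) (g : Plane → ℝ) (m n : ℕ),
        (∀ n, Continuous (f n)) → AEStronglyMeasurable g (volume.restrict T) →
        l2Norm T (fun x => f m x - f n x) ≤
          l2Norm T (fun x => f m x - g x) + l2Norm T (fun x => f n x - g x) := by
      intro f g m n hf hg
      have e : (fun x => f m x - f n x) = (fun x => f m x - g x) - fun x => f n x - g x := by
        ext; simp
      rw [l2Norm, e]
      exact eLpNorm_sub_le ((hf m).aestronglyMeasurable.sub hg)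
        ((hf n).aestronglyMeasurable.sub hg) one_le_two
    have hbound : ∀ m n, eLpNorm ((fun t => φ m (edgePath α θ h i t)) -
        fun t => φ n (edgePath α θ h i t)) 2 (volume.restrict (Set.Icc (0 : ℝ) 1)) ≤
          a m + a n := by
      intro m n
      refine (hC (fun x => φ m x - φ n x) ((hφ1 m).sub (hφ1 n))).trans ?_
      have hp : ∀ k, partialDeriv k (fun x => φ m x - φ n x) =
          fun x => partialDeriv k (φ m) x - partialDeriv k (φ n) x := fun k => by
        ext x
        simp only [partialDeriv]
        rw [fderiv_fun_sub ((hφ1 m).differentiable one_ne_zero x)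
          ((hφ1 n).differentiable one_ne_zero x)]
        simp
      rw [ha]
      simp only [hp]
      rw [← mul_add, add_add_add_comm, ← Finset.sum_add_distrib]
      gcongr with k
      · exact tri_ineq φ v m n (fun n => (hφ n).continuous) hv.1.1
      · exact tri_ineq (fun n => partialDeriv k (φ n)) (weakDeriv T k v) m n
          (fun n => continuous_partialDeriv (hφ1 n) k) (hv.memLp_weakDeriv k).1
    have hcau : CauchySeq fun n => (hmem n).toLp := by
      rw [EMetric.cauchySeq_iff]
      intro ε hε
      obtain ⟨N, hN⟩ := eventually_atTop.1 (ha0.eventually (gt_mem_nhds (ENNReal.half_pos hε.ne')))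
      refine ⟨N, fun m hm n hn => ?_⟩
      rw [Lp.edist_toLp_toLp]
      calc _ ≤ a m + a n := hbound m n
        _ < ε / 2 + ε / 2 := ENNReal.add_lt_add (hN m hm) (hN n hn)
        _ = ε := ENNReal.add_halves ε
    obtain ⟨G, hG⟩ := cauchySeq_tendsto_of_complete hcau
    refine ⟨G, Lp.memLp G, ?_⟩
    rw [Lp.tendsto_Lp_iff_tendsto_eLpNorm'] at hG
    refine hG.congr fun n => eLpNorm_congr_ae ?_
    filter_upwards [(hmem n).coeFn_toLp] with t ht
    simp [ht]
  choose G hGm hG using lim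
  set E : Fin 3 × Set.Ioo (0 : ℝ) 1 → Plane := fun p => edgePath α θ h p.1 p.2 with hE
  -- Only open edges are glued: two edges share each vertex, and the endpoints are null.
  have hinj : Function.Injective E := by
    rintro ⟨i, s⟩ ⟨j, t⟩ hst
    obtain ⟨rfl, h2⟩ := edgePath_inj hs hh s.2 t.2 hst
    rw [Subtype.ext h2]
  set g : Plane → ℝ := Function.extend E (fun p => G p.1 p.2) 0 with hg
  have hgG : ∀ i, (fun t => g (edgePath α θ h i t)) =ᵐ[volume.restrict (Set.Icc (0 : ℝ) 1)] G i := by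
    intro i
    rw [← restrict_Ioo_eq_restrict_Icc]
    filter_upwards [ae_restrict_mem measurableSet_Ioo] with t ht
    exact hinj.extend_apply (fun p : Fin 3 × Set.Ioo (0 : ℝ) 1 => G p.1 p.2) 0 (i, ⟨t, ht⟩)
  refine ⟨g, fun i => (hGm i).ae_eq (hgG i).symm, φ, hφ, hφv, hφd, fun i => ?_⟩
  refine (hG i).congr fun n => eLpNorm_congr_ae ?_
  filter_upwards [hgG i] with t ht
  rw [ht]

theorem isTrace_bdryTrace (hs : ShapeRange α θ) (hh : 0 < h) (hv : MemH1 (tri α θ h) v) :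
    IsTrace α θ h v (bdryTrace α θ h v) := by
  have := exists_isTrace hs hh hv
  rw [bdryTrace, dif_pos this]
  exact this.choose_spec

/-- The integral over `Ω` of `div ((x - W) v)`. -/
noncomputable def rayMoment (Ω : Set Plane) (W : Plane) (v : Plane → ℝ) : ℝ :=
  ∫ x in Ω, (2 * v x + ∑ k, weakDeriv Ω k v x * (x - W) k)

theorem rayMoment_eq {Ω : Set Plane} (hΩ : IsOpen Ω) (hb : Bornology.IsBounded Ω) (W : Plane)
    (hv : MemH1 Ω v) : rayMoment Ω W v = 2 * (∫ x in Ω, v x) +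
      ∑ k, ∫ x in Ω, weakDeriv Ω k v x * (x - W) k := by
  have := isFiniteMeasure_restrict hb
  have hk : ∀ k, Integrable (fun x => weakDeriv Ω k v x * (x - W) k) (volume.restrict Ω) :=
    fun k => MemLp.integrable_mul (hv.memLp_weakDeriv k)
      (memLp_of_continuous (p := 2) hb hΩ.measurableSet (by fun_prop))
  rw [rayMoment, integral_add ((hv.1.integrable one_le_two).const_mul 2)
    (integrable_finsetSum _ fun k _ => hk k), integral_finsetSum _ (fun k _ => hk k),
    integral_const_mul]

theorem setIntegral_tri_div' (hs : ShapeRange α θ) (hh : 0 < h) (i : Fin 3) {φ : Plane → ℝ}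
    (hφ : ContDiff ℝ 1 φ) :
    2 * volume.real (tri α θ h) * ∫ s in (0 : ℝ)..1, φ (edgePath α θ h i s) =
      2 * (∫ x in tri α θ h, φ x) +
        ∑ k, ∫ x in tri α θ h, partialDeriv k φ x * (x - oppVertex α θ h i) k := by
  have hi : ∀ {f : Plane → ℝ}, Continuous f → Integrable f (volume.restrict (tri α θ h)) :=
    fun hf => memLp_one_iff_integrable.1
      (memLp_of_continuous isBounded_tri isOpen_tri.measurableSet hf)
  have hk : ∀ k, Integrable (fun x => partialDeriv k φ x * (x - oppVertex α θ h i) k)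
      (volume.restrict (tri α θ h)) := fun k =>
    hi ((continuous_partialDeriv hφ k).mul (by fun_prop))
  rw [← setIntegral_tri_div hs hh i hφ]
  simp_rw [fderiv_apply_eq_sum]
  rw [integral_add ((hi hφ.continuous).const_mul 2)
    (integrable_finsetSum _ fun k _ => hk k), integral_finsetSum _ (fun k _ => hk k),
    integral_const_mul]

/-- The smooth divergence identity passes to the limit, its left side by convergence on the edge and
its right side by convergence in `H¹`. Hence the edge integral does not depend on the trace chosen.
-/
theorem IsTrace.integral_eq (hs : ShapeRange α θ) (hh : 0 < h) (hv : MemH1 (tri α θ h) v)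
    {g : Plane → ℝ} (hg : IsTrace α θ h v g) (i : Fin 3) :
    2 * volume.real (tri α θ h) * ∫ t in (0 : ℝ)..1, g (edgePath α θ h i t) =
      rayMoment (tri α θ h) (oppVertex α θ h i) v := by
  obtain ⟨hgm, φ, hφ, hφv, hφd, hφg⟩ := hg
  have := isFiniteMeasure_restrict (isBounded_tri (α := α) (θ := θ) (h := h))
  have hφ1 : ∀ n, ContDiff ℝ 1 (φ n) := fun n => (hφ n).of_le (by exact_mod_cast le_top)
  have hL : ∀ {f : Plane → ℝ}, Continuous f → MemLp f 2 (volume.restrict (tri α θ h)) :=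
    fun hf => memLp_of_continuous isBounded_tri isOpen_tri.measurableSet hf
  have l1 : Tendsto (fun n => ∫ t in (0 : ℝ)..1, φ n (edgePath α θ h i t)) atTop
      (𝓝 (∫ t in (0 : ℝ)..1, g (edgePath α θ h i t))) := by
    have := tendsto_integral_mul_of_eLpNorm (hgm i) (memLp_const 1)
      (fun n => memLp_edge (hφ n).continuous i) (hφg i)
    simpa only [mul_one, intervalIntegral.integral_of_le zero_le_one,
      integral_Icc_eq_integral_Ioc] using this
  have l2 : Tendsto (fun n => ∫ x in tri α θ h, φ n x) atTop (𝓝 (∫ x in tri α θ h, v x)) := by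
    have := tendsto_integral_mul_of_eLpNorm hv.1 (memLp_const 1)
      (fun n => hL (hφ n).continuous) hφv
    simpa only [mul_one] using this
  have l3 : ∀ k, Tendsto (fun n => ∫ x in tri α θ h,
      partialDeriv k (φ n) x * (x - oppVertex α θ h i) k) atTop
      (𝓝 (∫ x in tri α θ h, weakDeriv (tri α θ h) k v x * (x - oppVertex α θ h i) k)) := fun k =>
    tendsto_integral_mul_of_eLpNorm (hv.memLp_weakDeriv k) (hL (by fun_prop))
      (fun n => hL (continuous_partialDeriv (hφ1 n) k)) (hφd k)
  rw [rayMoment_eq isOpen_tri isBounded_tri _ hv]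
  refine tendsto_nhds_unique (l1.const_mul _) (((l2.const_mul 2).add
    (tendsto_finsetSum Finset.univ fun k _ => l3 k)).congr fun n => ?_)
  exact (setIntegral_tri_div' hs hh i (hφ1 n)).symm

/-- This removes traces from the rest of the argument: linearity and scaling of edge integrals are
read off from an integral over the triangle. -/
theorem edgeIntegral_eq (hs : ShapeRange α θ) (hh : 0 < h) (hv : MemH1 (tri α θ h) v)
    (i : Fin 3) : edgeIntegral α θ h i v = dist (edgeStart h i) (edgeEnd α θ h i) *
      (rayMoment (tri α θ h) (oppVertex α θ h i) v / (2 * volume.real (tri α θ h))) := by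
  have hV := volume_real_tri_pos hs hh
  rw [edgeIntegral, lineIntegral, ← (isTrace_bdryTrace hs hh hv).integral_eq hs hh hv i,
    mul_div_cancel_left₀ _ (by positivity)]

theorem lineIntegral_eq_of_contDiff (hs : ShapeRange α θ) (hh : 0 < h) {φ : Plane → ℝ}
    (hφ : ContDiff ℝ ∞ φ) (i : Fin 3) :
    lineIntegral α θ h i φ = dist (edgeStart h i) (edgeEnd α θ h i) *
      (rayMoment (tri α θ h) (oppVertex α θ h i) φ / (2 * volume.real (tri α θ h))) := by
  have hV := volume_real_tri_pos hs hh
  have hv := memH1_of_contDiff (isOpen_tri (α := α) (θ := θ) (h := h)) isBounded_tri hφ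
  rw [lineIntegral, rayMoment_eq isOpen_tri isBounded_tri _ hv]
  have e : ∀ k, ∫ x in tri α θ h, weakDeriv (tri α θ h) k φ x * (x - oppVertex α θ h i) k =
      ∫ x in tri α θ h, partialDeriv k φ x * (x - oppVertex α θ h i) k := fun k =>
    integral_congr_ae (((hasWeakDeriv_of_contDiff isOpen_tri isBounded_tri hφ k).weakDeriv_ae_eq
      isOpen_tri isBounded_tri).mul (ae_eq_refl _))
  simp_rw [e]
  rw [← setIntegral_tri_div' hs hh i (hφ.of_le (by exact_mod_cast le_top)),
    mul_div_cancel_left₀ _ (by positivity)]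

end Trace

/-! ### Suprema of quotients -/

section SupQuot

variable {Ω : Set Plane} {V : Set (Plane → ℝ)} {N D : (Plane → ℝ) → ℝ≥0∞}

theorem supQuot_le {M : ℝ≥0∞} (hM : ∀ v ∈ V, N v ≤ M * D v) : supQuot Ω V N D ≤ M :=
  iSup₂_le fun v hv => ENNReal.div_le_of_le_mul (hM v hv.1)

/-- The supremum omits null functions, hence `h0`. Finiteness is essential: if `D v = 0 < N v`, the
quotient is `⊤`, while `⊤ * 0 = 0`. This is why the numerical bounds are needed even for the
comparisons between constants. -/
theorem le_supQuot_mul {v : Plane → ℝ} (hv : v ∈ V) (h0 : v =ᵐ[volume.restrict Ω] 0 → N v = 0)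
    (hD : D v ≠ ⊤) (hfin : supQuot Ω V N D ≠ ⊤) : N v ≤ supQuot Ω V N D * D v := by
  by_cases hz : v =ᵐ[volume.restrict Ω] 0
  · simp [h0 hz]
  · rw [← ENNReal.div_le_iff_le_mul (.inr hfin) (.inl hD)]
    exact le_iSup₂ (f := fun v (_ : v ∈ {v ∈ V | ¬ v =ᵐ[volume.restrict Ω] 0}) => N v / D v)
      v ⟨hv, hz⟩

end SupQuot

/-! ### Finiteness of the semi-norms and relations between them -/

theorem l2Norm_eq_zero_of_ae_eq_zero {Ω : Set Plane} {v : Plane → ℝ}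
    (hv : v =ᵐ[volume.restrict Ω] 0) : l2Norm Ω v = 0 := by
  rw [l2Norm, eLpNorm_congr_ae hv, eLpNorm_zero]

theorem MemH1.h1Semi_ne_top {Ω : Set Plane} {v : Plane → ℝ} (hv : MemH1 Ω v) :
    h1Semi Ω v ≠ ⊤ := by
  refine ENNReal.rpow_ne_top_of_nonneg (by norm_num) (ENNReal.sum_ne_top.2 fun i _ => ?_)
  exact ENNReal.pow_ne_top (hv.memLp_weakDeriv i).2.ne

theorem MemH2.h2Semi_ne_top {Ω : Set Plane} {v : Plane → ℝ} (hv : MemH2 Ω v) :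
    h2Semi Ω v ≠ ⊤ := by
  refine ENNReal.rpow_ne_top_of_nonneg (by norm_num) (ENNReal.sum_ne_top.2 fun i _ =>
    ENNReal.sum_ne_top.2 fun j _ => ?_)
  exact ENNReal.pow_ne_top ((hv.2 j).memLp_weakDeriv i).2.ne

theorem h2Semi_sq (Ω : Set Plane) (v : Plane → ℝ) :
    h2Semi Ω v ^ 2 = ∑ j, h1Semi Ω (weakDeriv Ω j v) ^ 2 := by
  rw [h2Semi, ← ENNReal.rpow_natCast, ← ENNReal.rpow_mul, Finset.sum_comm]
  simp only [h1Semi_sq]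
  norm_num

theorem l2Norm_weakDeriv_le_h1Semi (Ω : Set Plane) (v : Plane → ℝ) (k : Fin 2) :
    l2Norm Ω (weakDeriv Ω k v) ≤ h1Semi Ω v := by
  rw [← ENNReal.pow_le_pow_left_iff two_ne_zero, h1Semi_sq]
  exact Finset.single_le_sum (f := fun i => l2Norm Ω (weakDeriv Ω i v) ^ 2)
    (fun _ _ => zero_le) (Finset.mem_univ k)

/-! ### Bounds for the constants -/

section Bounds

variable {α θ h : ℝ} {v : Plane → ℝ}

theorem norm_sub_le_of_mem_tri (hs : ShapeRange α θ) {x y : Plane} (hx : x ∈ tri α θ 1)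
    (hy : ‖y‖ ≤ 1) : ‖x - y‖ ≤ 2 := by
  have h1 := norm_sub_le x y
  have h3 : ‖x‖ ≤ 1 := by simpa using tri_subset_closedBall hs one_pos hx
  linarith

theorem l2Norm_sub_average_tri_le (hs : ShapeRange α θ) (hv : MemH1 (tri α θ 1) v) :
    l2Norm (tri α θ 1) (fun x => v x - ⨍ y in tri α θ 1, v y) ≤ 4 * h1Semi (tri α θ 1) v := by
  have := l2Norm_sub_average_le (d := 2) isOpen_tri isBounded_tri convex_tri
    (nonempty_tri hs one_pos) (fun x hx y hy => norm_sub_le_of_mem_tri hs hy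
      (by simpa using tri_subset_closedBall hs one_pos hx)) hv
  norm_num at this
  exact this

theorem C0_le (hs : ShapeRange α θ) : C0 α θ 1 ≤ 4 := by
  refine supQuot_le fun v hv => ?_
  have := l2Norm_sub_average_tri_le hs hv.1
  simpa [setAverage_eq, hv.2] using this

theorem dist_edge_ne_zero (hs : ShapeRange α θ) (hh : 0 < h) (i : Fin 3) :
    dist (edgeStart h i) (edgeEnd α θ h i) ≠ 0 := by
  rw [dist_ne_zero]
  intro he
  apply det_edge_ne_zero hs hh i
  simp [he]

theorem edgeIntegral_eq_zero_iff (hs : ShapeRange α θ) (hh : 0 < h) (hv : MemH1 (tri α θ h) v)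
    (i : Fin 3) :
    edgeIntegral α θ h i v = 0 ↔ rayMoment (tri α θ h) (oppVertex α θ h i) v = 0 := by
  have hV := (volume_real_tri_pos hs hh).ne'
  rw [edgeIntegral_eq hs hh hv i]
  simp [dist_edge_ne_zero hs hh i, hV]

/-- A vanishing edge integral gives `2∫v = -∫(x - W)·∇v`, and Cauchy–Schwarz bounds this by a
multiple of `|T|^(1/2) |v|₁`. The norm of the constant function is `|∫v| / |T|^(1/2)`, so the area
cancels. -/
theorem l2Norm_average_le (hs : ShapeRange α θ) (hv : MemH1 (tri α θ 1) v) {i : Fin 3}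
    (hi : edgeIntegral α θ 1 i v = 0) :
    l2Norm (tri α θ 1) (fun _ => ⨍ y in tri α θ 1, v y) ≤ 4 * h1Semi (tri α θ 1) v := by
  have hfin := isFiniteMeasure_restrict (isBounded_tri (α := α) (θ := θ) (h := 1))
  have hm := (edgeIntegral_eq_zero_iff hs one_pos hv i).1 hi
  rw [rayMoment_eq isOpen_tri isBounded_tri _ hv] at hm
  set T := tri α θ 1
  set W := oppVertex α θ 1 i
  set H := h1Semi T v
  set V := volume T
  have hV0 : V ≠ 0 := (isOpen_tri.measure_pos _ (nonempty_tri hs one_pos)).ne'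
  have hVt : V ≠ ⊤ := isBounded_tri.measure_lt_top.ne
  set R : ℝ≥0∞ := V ^ (1 / (2 : ℝ≥0∞).toReal) with hR
  have hRR : R * R = V := by
    rw [hR, ← ENNReal.rpow_add _ _ hV0 hVt]
    norm_num
  have hI : ∀ k, ‖∫ x in T, weakDeriv T k v x * (x - W) k‖ₑ ≤ H * (R * 2) := by
    intro k
    have hc : Continuous fun x : Plane => (x - W) k := by fun_prop
    refine (enorm_integral_mul_le (hv.memLp_weakDeriv k).1 hc.aestronglyMeasurable).trans ?_
    refine mul_le_mul' (l2Norm_weakDeriv_le_h1Semi T v k) ?_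
    refine (eLpNorm_le_of_ae_bound (C := 2) ?_).trans ?_
    · refine (ae_restrict_iff' isOpen_tri.measurableSet).2 (.of_forall fun x hx => ?_)
      exact (PiLp.norm_apply_le (x - W) k).trans
        (norm_sub_le_of_mem_tri hs hx (norm_oppVertex_le hs one_pos i))
    · simp [hR, V]
  have hint : ‖∫ x in T, v x‖ₑ ≤ 4 * H * R := by
    have e : ∫ x in T, v x = -(1 / 2) * ∑ k, ∫ x in T, weakDeriv T k v x * (x - W) k := by
      linarith
    rw [e, enorm_mul, Fin.sum_univ_two]
    -- The factor `1/2` is relaxed to 1, as sharp constants are not sought.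
    calc _ ≤ 1 * (H * (R * 2) + H * (R * 2)) := by
          refine mul_le_mul' ?_ ((enorm_add_le _ _).trans (add_le_add (hI 0) (hI 1)))
          rw [enorm_neg, Real.enorm_eq_ofReal (by norm_num)]
          exact ENNReal.ofReal_le_one.2 (by norm_num)
      _ = 4 * H * R := by ring
  have hav : ‖⨍ y in T, v y‖ₑ = V⁻¹ * ‖∫ x in T, v x‖ₑ := by
    rw [setAverage_eq, smul_eq_mul, enorm_mul, Real.enorm_eq_ofReal (by positivity),
      ENNReal.ofReal_inv_of_pos (volume_real_tri_pos hs one_pos)]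
    congr 2
    exact ENNReal.ofReal_toReal hVt
  rw [l2Norm, eLpNorm_const' _ two_ne_zero ENNReal.ofNat_ne_top, Measure.restrict_apply_univ, hav]
  calc V⁻¹ * ‖∫ x in T, v x‖ₑ * R ≤ V⁻¹ * (4 * H * R) * R := by gcongr
    _ = V⁻¹ * (R * R) * (4 * H) := by ring
    _ = 4 * H := by rw [hRR, ENNReal.inv_mul_cancel hV0 hVt, one_mul]

/-- The function is split into its deviation from the mean and its mean; each costs 4. -/
theorem C12_le (hs : ShapeRange α θ) : C12 α θ 1 ≤ 8 := by
  refine supQuot_le fun v hv => ?_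
  have h1 := l2Norm_sub_average_tri_le hs hv.1
  have h2 := l2Norm_average_le hs hv.1 (hv.2 0 (by simp))
  have e : v = (fun x => v x - ⨍ y in tri α θ 1, v y) + fun _ => ⨍ y in tri α θ 1, v y := by
    ext x; simp
  calc l2Norm (tri α θ 1) v
      ≤ l2Norm (tri α θ 1) (fun x => v x - ⨍ y in tri α θ 1, v y) +
          l2Norm (tri α θ 1) (fun _ => ⨍ y in tri α θ 1, v y) := by
        conv_lhs => rw [e]
        exact eLpNorm_add_le (hv.1.1.1.sub aestronglyMeasurable_const) aestronglyMeasurable_const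
          one_le_two
    _ ≤ 4 * h1Semi (tri α θ 1) v + 4 * h1Semi (tri α θ 1) v := add_le_add h1 h2
    _ = 8 * h1Semi (tri α θ 1) v := by ring

theorem C123_le_C12 (α θ h : ℝ) : C123 α θ h ≤ C12 α θ h := by
  refine iSup₂_le fun v hv => ?_
  refine le_iSup₂ (f := fun v (_ : v ∈ {v ∈ VEdge {0, 1} α θ h |
    ¬ v =ᵐ[volume.restrict (tri α θ h)] 0}) => l2Norm (tri α θ h) v / h1Semi (tri α θ h) v)
    v ⟨⟨hv.1.1, fun i hi => hv.1.2 i ?_⟩, hv.2⟩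
  rcases hi with rfl | rfl <;> simp

/-- The moments at two vertices differ by `(W_i - W_j)·∫∇v`. When all three vanish, `∫∇v` is
orthogonal to two linearly independent sides. -/
theorem integral_weakDeriv_eq_zero (hs : ShapeRange α θ) (hh : 0 < h) (hv : MemH1 (tri α θ h) v)
    (he : ∀ i, edgeIntegral α θ h i v = 0) (k : Fin 2) :
    ∫ x in tri α θ h, weakDeriv (tri α θ h) k v x = 0 := by
  have hfin := isFiniteMeasure_restrict (isBounded_tri (α := α) (θ := θ) (h := h))
  set T := tri α θ h
  set I : Fin 2 → ℝ := fun k => ∫ x in T, weakDeriv T k v x with hI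
  have hL : ∀ {f : Plane → ℝ}, Continuous f → MemLp f 2 (volume.restrict T) :=
    fun hf => memLp_of_continuous isBounded_tri isOpen_tri.measurableSet hf
  have hW : ∀ i, rayMoment T (oppVertex α θ h i) v = rayMoment T 0 v -
      ∑ k, oppVertex α θ h i k * I k := by
    intro i
    rw [rayMoment_eq isOpen_tri isBounded_tri _ hv, rayMoment_eq isOpen_tri isBounded_tri _ hv,
      add_sub_assoc, ← Finset.sum_sub_distrib]
    congr 2
    ext k
    rw [hI, ← integral_const_mul, ← integral_sub]
    · congr 1; ext x; simp; ring
    · exact MemLp.integrable_mul (hv.memLp_weakDeriv k) (hL (by fun_prop))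
    · exact ((hv.memLp_weakDeriv k).integrable one_le_two).const_mul _
  have hz : ∀ i, rayMoment T (oppVertex α θ h i) v = 0 := fun i =>
    (edgeIntegral_eq_zero_iff hs hh hv i).1 (he i)
  have h0 := hW 0
  have h1 := hW 1
  have h2 := hW 2
  rw [hz] at h0 h1 h2
  simp only [oppVertex, vertexO, vertexA, vertexB, Fin.sum_univ_two, Matrix.cons_val_zero,
    Matrix.cons_val_one, Matrix.cons_val_two, Matrix.tail_cons, Matrix.head_cons] at h0 h1 h2
  have i0 : h * I 0 = 0 := by linarith
  have i0' : I 0 = 0 := (mul_eq_zero.1 i0).resolve_left hh.ne'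
  have i1 : α * h * Real.sin θ * I 1 = 0 := by rw [i0'] at h0; linarith
  have i1' : I 1 = 0 := (mul_eq_zero.1 i1).resolve_left
    (mul_pos (mul_pos hs.1 hh) hs.sin_pos).ne'
  fin_cases k
  · exact i0'
  · exact i1'

/-- Each `∂ₖv` has mean zero, so the inequality defining `C₀` applies to it; the squares are then
summed over `k`. -/
theorem h1Semi_le_C0_mul_h2Semi (hs : ShapeRange α θ) (hv : v ∈ V4 α θ 1) :
    h1Semi (tri α θ 1) v ≤ C0 α θ 1 * h2Semi (tri α θ 1) v := by
  rw [← ENNReal.pow_le_pow_left_iff two_ne_zero, mul_pow, h1Semi_sq, h2Semi_sq, Finset.mul_sum]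
  refine Finset.sum_le_sum fun k _ => ?_
  rw [← mul_pow]
  gcongr
  exact le_supQuot_mul (V := V0 α θ 1)
    ⟨hv.1.2 k, integral_weakDeriv_eq_zero hs one_pos hv.1.1 hv.2 k⟩
    l2Norm_eq_zero_of_ae_eq_zero (hv.1.2 k).h1Semi_ne_top
    (ne_top_of_le_ne_top (by simp) (C0_le hs))

theorem C4_le_C0 (hs : ShapeRange α θ) : C4 α θ 1 ≤ C0 α θ 1 :=
  supQuot_le fun _ hv => h1Semi_le_C0_mul_h2Semi hs hv

theorem C123_le (hs : ShapeRange α θ) : C123 α θ 1 ≤ 8 := (C123_le_C12 α θ 1).trans (C12_le hs)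

theorem C5_le_C0_mul_C123 (hs : ShapeRange α θ) : C5 α θ 1 ≤ C0 α θ 1 * C123 α θ 1 := by
  refine supQuot_le fun v hv => ?_
  have h1 : l2Norm (tri α θ 1) v ≤ C123 α θ 1 * h1Semi (tri α θ 1) v :=
    le_supQuot_mul (V := VEdge {0, 1, 2} α θ 1) ⟨hv.1.1, fun i _ => hv.2 i⟩
      l2Norm_eq_zero_of_ae_eq_zero hv.1.1.h1Semi_ne_top
      (ne_top_of_le_ne_top (by simp) (C123_le hs))
  calc l2Norm (tri α θ 1) v ≤ C123 α θ 1 * h1Semi (tri α θ 1) v := h1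
    _ ≤ C123 α θ 1 * (C0 α θ 1 * h2Semi (tri α θ 1) v) := by
        gcongr; exact h1Semi_le_C0_mul_h2Semi hs hv
    _ = _ := by ring

theorem C4_le (hs : ShapeRange α θ) : C4 α θ 1 ≤ 4 := (C4_le_C0 hs).trans (C0_le hs)

theorem C5_le (hs : ShapeRange α θ) : C5 α θ 1 ≤ 32 :=
  calc C5 α θ 1 ≤ C0 α θ 1 * C123 α θ 1 := C5_le_C0_mul_C123 hs
    _ ≤ 4 * 8 := mul_le_mul' (C0_le hs) (C123_le hs)
    _ = 32 := by norm_num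

end Bounds

/-! ### Scaling to the unit triangle -/

section ScalingTri

variable {α θ h : ℝ} {v : Plane → ℝ}

theorem vertices_smul (α θ h : ℝ) : vertexO = h • vertexO ∧ vertexA h = h • vertexA 1 ∧
    vertexB α θ h = h • vertexB α θ 1 := by
  refine ⟨?_, ?_, ?_⟩ <;> ext j <;> fin_cases j <;> simp [vertexO, vertexA, vertexB] <;> ring

theorem tri_one_eq_preimage (hh : 0 < h) :
    tri α θ 1 = (fun x : Plane => h • x) ⁻¹' tri α θ h := by
  obtain ⟨h1, h2, h3⟩ := vertices_smul α θ h
  have e : (fun x : Plane => h • x) ⁻¹' tri α θ h = interior ((fun x : Plane => h • x) ⁻¹'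
      convexHull ℝ {vertexO, vertexA h, vertexB α θ h}) :=
    (Homeomorph.smulOfNeZero h hh.ne').preimage_interior _
  rw [e, tri]
  congr 1
  ext x
  rw [Set.mem_preimage, h2, h3]
  conv_rhs => rw [h1]
  simp only [mem_convexHull_triple_iff]
  have : ∀ r s : ℝ, h • vertexO + (r • (h • vertexA 1 - h • vertexO) +
      (r * s) • (h • vertexB α θ 1 - h • vertexA 1)) = h • (vertexO + (r • (vertexA 1 - vertexO) +
      (r * s) • (vertexB α θ 1 - vertexA 1))) := fun r s => by module
  simp only [this, (smul_right_injective Plane hh.ne').eq_iff]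

theorem oppVertex_smul (α θ h : ℝ) (i : Fin 3) : oppVertex α θ h i = h • oppVertex α θ 1 i := by
  obtain ⟨h1, h2, h3⟩ := vertices_smul α θ h
  fin_cases i
  · exact h3
  · exact h2
  · exact h1

theorem weakDeriv_comp_smul (hh : 0 < h) (hv : MemH1 (tri α θ h) v) (k : Fin 2) :
    weakDeriv (tri α θ 1) k (fun x => v (h • x)) =ᵐ[volume.restrict (tri α θ 1)]
      fun x => h * weakDeriv (tri α θ h) k v (h • x) :=
  ((hasWeakDeriv_weakDeriv (hv.2 k)).comp_smul hh (tri_one_eq_preimage hh)).weakDeriv_ae_eq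
    isOpen_tri isBounded_tri

theorem rayMoment_comp_smul (hh : 0 < h) (hv : MemH1 (tri α θ h) v) (i : Fin 3) :
    rayMoment (tri α θ 1) (oppVertex α θ 1 i) (fun x => v (h • x)) =
      (h ^ 2)⁻¹ * rayMoment (tri α θ h) (oppVertex α θ h i) v := by
  rw [rayMoment, rayMoment, ← integral_comp_smul_restrict hh (tri_one_eq_preimage hh)]
  refine integral_congr_ae ?_
  filter_upwards [weakDeriv_comp_smul hh hv 0, weakDeriv_comp_smul hh hv 1] with x h0 h1
  simp only [Fin.sum_univ_two, h0, h1, oppVertex_smul α θ h i, ← smul_sub, PiLp.smul_apply,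
    smul_eq_mul]
  ring

/-- In the plane the factor `h` from the chain rule cancels the `h⁻¹` from the `L²` norm, so `|·|₁`
is invariant under scaling; a second derivative leaves one factor `h`. -/
theorem l2Norm_weakDeriv_comp_smul (hh : 0 < h) (hv : MemH1 (tri α θ h) v) (k : Fin 2) :
    l2Norm (tri α θ 1) (weakDeriv (tri α θ 1) k (fun x => v (h • x))) =
      l2Norm (tri α θ h) (weakDeriv (tri α θ h) k v) := by
  rw [l2Norm_comp_smul hh (tri_one_eq_preimage hh) (weakDeriv (tri α θ h) k v), l2Norm,
    eLpNorm_congr_ae (weakDeriv_comp_smul hh hv k)]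
  have := eLpNorm_const_smul h (fun x => weakDeriv (tri α θ h) k v (h • x)) 2
    (volume.restrict (tri α θ 1))
  rw [Real.enorm_eq_ofReal hh.le] at this
  exact this

theorem h1Semi_comp_smul (hh : 0 < h) (hv : MemH1 (tri α θ h) v) :
    h1Semi (tri α θ 1) (fun x => v (h • x)) = h1Semi (tri α θ h) v := by
  simp only [h1Semi, l2Norm_weakDeriv_comp_smul hh hv]

theorem h1Semi_congr {Ω : Set Plane} (hΩ : IsOpen Ω) (hb : Bornology.IsBounded Ω)
    {v v' : Plane → ℝ} (hv : MemH1 Ω v) (h : v =ᵐ[volume.restrict Ω] v') :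
    h1Semi Ω v = h1Semi Ω v' := by
  simp only [h1Semi, l2Norm, eLpNorm_congr_ae (weakDeriv_congr hΩ hb hv h _)]

theorem HasWeakDeriv.const_mul {Ω : Set Plane} {v w : Plane → ℝ} {i : Fin 2}
    (hw : HasWeakDeriv Ω i v w) (c : ℝ) :
    HasWeakDeriv Ω i (fun x => c * v x) (fun x => c * w x) := by
  refine ⟨hw.1.const_mul c, fun φ h1 h2 h3 => ?_⟩
  simp_rw [mul_assoc]
  rw [integral_const_mul, integral_const_mul, hw.2 φ h1 h2 h3]
  ring

theorem MemH1.const_mul {Ω : Set Plane} {v : Plane → ℝ} (hv : MemH1 Ω v) (c : ℝ) :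
    MemH1 Ω (fun x => c * v x) :=
  ⟨hv.1.const_mul c, fun i => ⟨_, (hasWeakDeriv_weakDeriv (hv.2 i)).const_mul c⟩⟩

theorem h1Semi_const_mul {Ω : Set Plane} (hΩ : IsOpen Ω) (hb : Bornology.IsBounded Ω)
    {v : Plane → ℝ} (hv : MemH1 Ω v) {c : ℝ} (hc : 0 ≤ c) :
    h1Semi Ω (fun x => c * v x) = ENNReal.ofReal c * h1Semi Ω v := by
  refine (ENNReal.pow_right_strictMono two_ne_zero).injective ?_
  rw [mul_pow, h1Semi_sq, h1Semi_sq, Finset.mul_sum]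
  refine Finset.sum_congr rfl fun i _ => ?_
  rw [l2Norm, eLpNorm_congr_ae (((hasWeakDeriv_weakDeriv (hv.2 i)).const_mul c).weakDeriv_ae_eq
    hΩ hb), ← mul_pow, ← Real.enorm_eq_ofReal hc]
  congr 1
  exact eLpNorm_const_smul c (weakDeriv Ω i v) 2 (volume.restrict Ω)

theorem MemH2.comp_smul (hh : 0 < h) (hv : MemH2 (tri α θ h) v) :
    MemH2 (tri α θ 1) (fun x => v (h • x)) :=
  ⟨hv.1.comp_smul hh (tri_one_eq_preimage hh), fun k =>
    (((hv.2 k).comp_smul hh (tri_one_eq_preimage hh)).const_mul h).congr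
      (weakDeriv_comp_smul hh hv.1 k).symm⟩

theorem h2Semi_comp_smul (hh : 0 < h) (hv : MemH2 (tri α θ h) v) :
    h2Semi (tri α θ 1) (fun x => v (h • x)) = ENNReal.ofReal h * h2Semi (tri α θ h) v := by
  refine (ENNReal.pow_right_strictMono two_ne_zero).injective ?_
  beta_reduce
  rw [mul_pow, h2Semi_sq, h2Semi_sq, Finset.mul_sum]
  refine Finset.sum_congr rfl fun k _ => ?_
  have hk := (hv.2 k).comp_smul hh (tri_one_eq_preimage hh)
  rw [← h1Semi_congr isOpen_tri isBounded_tri (hk.const_mul h)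
    (weakDeriv_comp_smul hh hv.1 k).symm, h1Semi_const_mul isOpen_tri isBounded_tri hk hh.le,
    h1Semi_comp_smul hh (hv.2 k), mul_pow]

/-- Vanishing edge integrals are transported through `rayMoment`, which is homogeneous under
scaling, so no trace has to be rescaled. -/
theorem comp_smul_mem_V4 (hs : ShapeRange α θ) (hh : 0 < h) (hv : v ∈ V4 α θ h) :
    (fun x => v (h • x)) ∈ V4 α θ 1 := by
  have h2 := hv.1.comp_smul hh
  refine ⟨h2, fun i => ?_⟩
  rw [edgeIntegral_eq_zero_iff hs one_pos h2.1, rayMoment_comp_smul hh hv.1.1,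
    (edgeIntegral_eq_zero_iff hs hh hv.1.1 i).1 (hv.2 i), mul_zero]

theorem h1Semi_le_C4 (hs : ShapeRange α θ) (hh : 0 < h) (hv : v ∈ V4 α θ h) :
    h1Semi (tri α θ h) v ≤ C4 α θ 1 * ENNReal.ofReal h * h2Semi (tri α θ h) v := by
  have hw := comp_smul_mem_V4 hs hh hv
  rw [← h1Semi_comp_smul hh hv.1.1, mul_assoc, ← h2Semi_comp_smul hh hv.1]
  exact le_supQuot_mul hw (h1Semi_eq_zero_of_ae_eq_zero isOpen_tri isBounded_tri)
    hw.1.h2Semi_ne_top (ne_top_of_le_ne_top (by simp) (C4_le hs))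

/-- One factor `h` comes from scaling the `L²` norm, the other from `|·|₂`. -/
theorem l2Norm_le_C5 (hs : ShapeRange α θ) (hh : 0 < h) (hv : v ∈ V4 α θ h) :
    l2Norm (tri α θ h) v ≤ C5 α θ 1 * ENNReal.ofReal h ^ 2 * h2Semi (tri α θ h) v := by
  have hw := comp_smul_mem_V4 hs hh hv
  have key : l2Norm (tri α θ 1) (fun x => v (h • x)) ≤
      C5 α θ 1 * h2Semi (tri α θ 1) (fun x => v (h • x)) :=
    le_supQuot_mul hw l2Norm_eq_zero_of_ae_eq_zero
      hw.1.h2Semi_ne_top (ne_top_of_le_ne_top (by simp) (C5_le hs))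
  rw [h2Semi_comp_smul hh hv.1] at key
  calc l2Norm (tri α θ h) v = ENNReal.ofReal h * l2Norm (tri α θ 1) (fun x => v (h • x)) :=
        l2Norm_comp_smul hh (tri_one_eq_preimage hh) v
    _ ≤ ENNReal.ofReal h * (C5 α θ 1 * (ENNReal.ofReal h * h2Semi (tri α θ h) v)) := by gcongr
    _ = _ := by ring

end ScalingTri

/-! ### The interpolant -/

section Interpolant

variable {α θ h : ℝ} {v : Plane → ℝ}

theorem affine_apply_eq (p : Plane →ᵃ[ℝ] ℝ) (x : Plane) :
    p x = LinearMap.toContinuousLinearMap p.linear x + p 0 := by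
  simpa using congrFun p.decomp x

theorem contDiff_affine (p : Plane →ᵃ[ℝ] ℝ) : ContDiff ℝ ∞ p := by
  rw [show (p : Plane → ℝ) = fun x => LinearMap.toContinuousLinearMap p.linear x + p 0 from
    funext (affine_apply_eq p)]
  exact (ContinuousLinearMap.contDiff _).add contDiff_const

theorem partialDeriv_affine (p : Plane →ᵃ[ℝ] ℝ) (k : Fin 2) :
    partialDeriv k p = fun _ => p.linear (EuclideanSpace.single k 1) := by
  ext x
  have : HasFDerivAt p (LinearMap.toContinuousLinearMap p.linear) x := by
    rw [show (p : Plane → ℝ) = fun x => LinearMap.toContinuousLinearMap p.linear x + p 0 from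
      funext (affine_apply_eq p)]
    exact (ContinuousLinearMap.hasFDerivAt _).add_const _
  rw [partialDeriv, this.fderiv]
  rfl

theorem lineIntegral_affine (α θ h : ℝ) (i : Fin 3) (p : Plane →ᵃ[ℝ] ℝ) :
    lineIntegral α θ h i p = dist (edgeStart h i) (edgeEnd α θ h i) *
      ((p (edgeStart h i) + p (edgeEnd α θ h i)) / 2) := by
  rw [lineIntegral]
  congr 1
  simp only [edgePath, AffineMap.apply_lineMap]
  simp only [AffineMap.lineMap_apply_module, smul_eq_mul]
  set a := p (edgeStart h i)
  set b := p (edgeEnd α θ h i)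
  have e : ∀ t : ℝ, (1 - t) * a + t * b = a + t * (b - a) := fun t => by ring
  simp_rw [e]
  rw [intervalIntegral.integral_add (by simp) (Continuous.intervalIntegrable (by fun_prop) _ _),
    intervalIntegral.integral_mul_const]
  simp
  ring

theorem exists_affine_eq (hs : ShapeRange α θ) (hh : 0 < h) (a b c : ℝ) :
    ∃! p : Plane →ᵃ[ℝ] ℝ, p vertexO = a ∧ p (vertexA h) = b ∧ p (vertexB α θ h) = c := by
  have hdet : (vertexA h) 0 * (vertexB α θ h) 1 - (vertexA h) 1 * (vertexB α θ h) 0 ≠ 0 := by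
    simp [vertexA, vertexB, hh.ne', hs.1.ne', hs.sin_pos.ne']
  obtain ⟨e, he⟩ := exists_continuousLinearEquiv hdet
  have hO : vertexO = 0 := by ext j; fin_cases j <;> simp [vertexO]
  have heA : e.symm (vertexA h) = (1, 0) := by rw [e.symm_apply_eq, he]; simp
  have heB : e.symm (vertexB α θ h) = (0, 1) := by rw [e.symm_apply_eq, he]; simp
  let L : Plane →ₗ[ℝ] ℝ := ((b - a) • LinearMap.fst ℝ ℝ ℝ + (c - a) • LinearMap.snd ℝ ℝ ℝ) ∘ₗ
    (e.symm : Plane →L[ℝ] ℝ × ℝ).toLinearMap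
  let p : Plane →ᵃ[ℝ] ℝ := L.toAffineMap + AffineMap.const ℝ Plane a
  have hp : ∀ x, p x = (b - a) * (e.symm x).1 + (c - a) * (e.symm x).2 + a := fun x => by
    simp [p, L]
  refine ⟨p, ⟨?_, ?_, ?_⟩, fun q ⟨q1, q2, q3⟩ => ?_⟩
  · simp [hp, hO]
  · simp [hp, heA]
  · simp [hp, heB]
  · ext x
    have hx : x = (e.symm x).1 • vertexA h + (e.symm x).2 • vertexB α θ h := by
      rw [← he]; simp
    rw [hO] at q1
    have hA : q.linear (vertexA h) = b - a := by
      have := affine_apply_eq q (vertexA h)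
      simp only [LinearMap.coe_toContinuousLinearMap'] at this
      linarith
    have hB : q.linear (vertexB α θ h) = c - a := by
      have := affine_apply_eq q (vertexB α θ h)
      simp only [LinearMap.coe_toContinuousLinearMap'] at this
      linarith
    rw [hp, affine_apply_eq q x, LinearMap.coe_toContinuousLinearMap']
    conv_lhs => rw [hx]
    rw [map_add, map_smul, map_smul, hA, hB, q1]
    simp only [smul_eq_mul]
    ring

/-- The mean of an affine function over an edge is the half-sum of its end values. Prescribing the
three means `m i` is thus an invertible system for the vertex values, which determine the function.
-/
theorem existsUnique_isCRInterpolant (hs : ShapeRange α θ) (hh : 0 < h) (v : Plane → ℝ) :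
    ∃! p : Plane →ᵃ[ℝ] ℝ, IsCRInterpolant α θ h v p := by
  set m : Fin 3 → ℝ := fun i => edgeIntegral α θ h i v / dist (edgeStart h i) (edgeEnd α θ h i)
  have key : ∀ p : Plane →ᵃ[ℝ] ℝ, IsCRInterpolant α θ h v p ↔
      (p vertexO = m 0 + m 1 - m 2 ∧ p (vertexA h) = m 0 + m 2 - m 1 ∧
        p (vertexB α θ h) = m 1 + m 2 - m 0) := by
    intro p
    have h1 : ∀ i, lineIntegral α θ h i p = edgeIntegral α θ h i v ↔
        (p (edgeStart h i) + p (edgeEnd α θ h i)) / 2 = m i := fun i => by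
      rw [lineIntegral_affine, eq_div_iff (dist_edge_ne_zero hs hh i), mul_comm]
    simp only [IsCRInterpolant, h1, Fin.forall_fin_succ, edgeStart, edgeEnd]
    simp
    constructor
    · rintro ⟨h0, h1, h2⟩
      exact ⟨by linarith, by linarith, by linarith⟩
    · rintro ⟨h0, h1, h2⟩
      exact ⟨by linarith, by linarith, by linarith⟩
  simp only [key]
  exact exists_affine_eq hs hh _ _ _

theorem rayMoment_sub {Ω : Set Plane} (hΩ : IsOpen Ω) (hb : Bornology.IsBounded Ω) (W : Plane)
    {v v' : Plane → ℝ} (hv : MemH1 Ω v) (hv' : MemH1 Ω v') :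
    rayMoment Ω W (fun x => v x - v' x) = rayMoment Ω W v - rayMoment Ω W v' := by
  have hfin := isFiniteMeasure_restrict hb
  have hi : ∀ {u : Plane → ℝ}, MemH1 Ω u → Integrable
      (fun x => 2 * u x + ∑ k, weakDeriv Ω k u x * (x - W) k) (volume.restrict Ω) := fun hu =>
    ((hu.1.integrable one_le_two).const_mul 2).add (integrable_finsetSum _ fun k _ =>
      MemLp.integrable_mul (hu.memLp_weakDeriv k)
        (memLp_of_continuous (p := 2) hb hΩ.measurableSet (by fun_prop)))
  rw [rayMoment, rayMoment, rayMoment, ← integral_sub (hi hv) (hi hv')]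
  refine integral_congr_ae ?_
  filter_upwards [weakDeriv_sub hΩ hb hv hv' 0, weakDeriv_sub hΩ hb hv hv' 1] with x h0 h1
  simp only [Fin.sum_univ_two, h0, h1]
  ring

theorem weakDeriv_sub_affine {Ω : Set Plane} (hΩ : IsOpen Ω) (hb : Bornology.IsBounded Ω)
    {v : Plane → ℝ} (hv : MemH1 Ω v) (p : Plane →ᵃ[ℝ] ℝ) (k : Fin 2) :
    weakDeriv Ω k (fun x => v x - p x) =ᵐ[volume.restrict Ω]
      fun x => weakDeriv Ω k v x - p.linear (EuclideanSpace.single k 1) := by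
  have hp := hasWeakDeriv_of_contDiff hΩ hb (contDiff_affine p) k
  rw [partialDeriv_affine] at hp
  exact ((hasWeakDeriv_weakDeriv (hv.2 k)).sub hb hv.1
    (memLp_of_continuous hb hΩ.measurableSet (contDiff_affine p).continuous) hp).weakDeriv_ae_eq
      hΩ hb

theorem MemH2.sub_affine {Ω : Set Plane} (hΩ : IsOpen Ω) (hb : Bornology.IsBounded Ω)
    {v : Plane → ℝ} (hv : MemH2 Ω v) (p : Plane →ᵃ[ℝ] ℝ) : MemH2 Ω (fun x => v x - p x) :=
  ⟨hv.1.sub hb (memH1_of_contDiff hΩ hb (contDiff_affine p)), fun k =>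
    ((hv.2 k).sub hb (memH1_of_contDiff hΩ hb contDiff_const)).congr
      (weakDeriv_sub_affine hΩ hb hv.1 p k).symm⟩

theorem h2Semi_sub_affine {Ω : Set Plane} (hΩ : IsOpen Ω) (hb : Bornology.IsBounded Ω)
    {v : Plane → ℝ} (hv : MemH2 Ω v) (p : Plane →ᵃ[ℝ] ℝ) :
    h2Semi Ω (fun x => v x - p x) = h2Semi Ω v := by
  have e : ∀ i k, l2Norm Ω (weakDeriv Ω i (weakDeriv Ω k fun x => v x - p x)) =
      l2Norm Ω (weakDeriv Ω i (weakDeriv Ω k v)) := by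
    intro i k
    refine eLpNorm_congr_ae ?_
    refine (weakDeriv_congr hΩ hb ((hv.sub_affine hΩ hb p).2 k)
      (weakDeriv_sub_affine hΩ hb hv.1 p k) i).trans ?_
    -- The gradient of `p` is constant, so the same lemma, applied now to a constant affine map,
    -- shows that `p` contributes nothing to second derivatives.
    simpa using weakDeriv_sub_affine hΩ hb (hv.2 k)
      (AffineMap.const ℝ Plane (p.linear (EuclideanSpace.single k 1))) i
  simp only [h2Semi, e]

/-- Both sides of the interpolation condition are multiples of `rayMoment` with the same factor, and
`rayMoment` is additive; linearity of the chosen trace is not needed. -/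
theorem sub_interpolant_mem_V4 (hs : ShapeRange α θ) (hh : 0 < h) (hv : MemH2 (tri α θ h) v)
    {p : Plane →ᵃ[ℝ] ℝ} (hp : IsCRInterpolant α θ h v p) : (fun x => v x - p x) ∈ V4 α θ h := by
  have hu := hv.sub_affine isOpen_tri isBounded_tri p
  refine ⟨hu, fun i => ?_⟩
  have hV := (volume_real_tri_pos hs hh).ne'
  have h1 := hp i
  rw [lineIntegral_eq_of_contDiff hs hh (contDiff_affine p), edgeIntegral_eq hs hh hv.1,
    mul_right_inj' (dist_edge_ne_zero hs hh i), div_left_inj' (by simpa using hV)] at h1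
  rw [edgeIntegral_eq_zero_iff hs hh hu.1, rayMoment_sub isOpen_tri isBounded_tri _ hv.1
    (memH1_of_contDiff isOpen_tri isBounded_tri (contDiff_affine p)), h1, sub_self]

theorem h1Semi_sub_interpolant_le (hs : ShapeRange α θ) (hh : 0 < h) (hv : MemH2 (tri α θ h) v)
    {p : Plane →ᵃ[ℝ] ℝ} (hp : IsCRInterpolant α θ h v p) :
    h1Semi (tri α θ h) (fun x => v x - p x) ≤
      C4 α θ 1 * ENNReal.ofReal h * h2Semi (tri α θ h) v := by
  rw [← h2Semi_sub_affine isOpen_tri isBounded_tri hv p]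
  exact h1Semi_le_C4 hs hh (sub_interpolant_mem_V4 hs hh hv hp)

theorem l2Norm_sub_interpolant_le (hs : ShapeRange α θ) (hh : 0 < h) (hv : MemH2 (tri α θ h) v)
    {p : Plane →ᵃ[ℝ] ℝ} (hp : IsCRInterpolant α θ h v p) :
    l2Norm (tri α θ h) (fun x => v x - p x) ≤
      C5 α θ 1 * ENNReal.ofReal h ^ 2 * h2Semi (tri α θ h) v := by
  rw [← h2Semi_sub_affine isOpen_tri isBounded_tri hv p]
  exact l2Norm_le_C5 hs hh (sub_interpolant_mem_V4 hs hh hv hp)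

end Interpolant

end CRTri

/-! ### The theorem -/

theorem mainTheorem3 :
    -- the relations between the constants
    (∀ α θ : ℝ, ShapeRange α θ →
      C4 α θ 1 ≤ C0 α θ 1 ∧
      C5 α θ 1 ≤ C0 α θ 1 * C123 α θ 1 ∧
      C0 α θ 1 * C123 α θ 1 ≤ C0 α θ 1 * C12 α θ 1) ∧
    -- the interpolant is well defined
    (∀ α θ h : ℝ, ShapeRange α θ → 0 < h → ∀ v : Plane → ℝ, MemH1 (tri α θ h) v →
      ∃! p : Plane →ᵃ[ℝ] ℝ, IsCRInterpolant α θ h v p) ∧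
    -- the interpolation error estimates
    (∀ α θ h : ℝ, ShapeRange α θ → 0 < h → ∀ v : Plane → ℝ, MemH2 (tri α θ h) v →
      ∀ p : Plane →ᵃ[ℝ] ℝ, IsCRInterpolant α θ h v p →
        h1Semi (tri α θ h) (fun x => v x - p x) ≤
          C4 α θ 1 * ENNReal.ofReal h * h2Semi (tri α θ h) v ∧
        h1Semi (tri α θ h) (fun x => v x - p x) ≤
          C0 α θ 1 * ENNReal.ofReal h * h2Semi (tri α θ h) v ∧
        l2Norm (tri α θ h) (fun x => v x - p x) ≤
          C5 α θ 1 * ENNReal.ofReal h ^ 2 * h2Semi (tri α θ h) v ∧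
        l2Norm (tri α θ h) (fun x => v x - p x) ≤
          C0 α θ 1 * C123 α θ 1 * ENNReal.ofReal h ^ 2 * h2Semi (tri α θ h) v ∧
        l2Norm (tri α θ h) (fun x => v x - p x) ≤
          C0 α θ 1 * C12 α θ 1 * ENNReal.ofReal h ^ 2 * h2Semi (tri α θ h) v) ∧
    -- no angle condition: everything is bounded uniformly in the shape of the triangle
    (∃ M : ℝ≥0,
      (∀ α θ : ℝ, ShapeRange α θ →
        C0 α θ 1 ≤ M ∧ C12 α θ 1 ≤ M ∧ C123 α θ 1 ≤ M ∧ C4 α θ 1 ≤ M ∧ C5 α θ 1 ≤ M) ∧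
      (∀ α θ h : ℝ, ShapeRange α θ → 0 < h → ∀ v : Plane → ℝ, MemH2 (tri α θ h) v →
        ∀ p : Plane →ᵃ[ℝ] ℝ, IsCRInterpolant α θ h v p →
          h1Semi (tri α θ h) (fun x => v x - p x) ≤
            M * ENNReal.ofReal h * h2Semi (tri α θ h) v ∧
          l2Norm (tri α θ h) (fun x => v x - p x) ≤
            M * ENNReal.ofReal h ^ 2 * h2Semi (tri α θ h) v)) := by
  -- `M = 32 = 4 · 8` is the bound for `C₅`, the largest of the five.
  have hM : ∀ {x y : ℝ≥0∞}, x ≤ y → y ≤ (32 : ℝ≥0∞) → x ≤ ((32 : ℝ≥0) : ℝ≥0∞) :=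
    fun h1 h2 => by simpa using h1.trans h2
  have h4 : (4 : ℝ≥0∞) ≤ 32 := by norm_num
  have h8 : (8 : ℝ≥0∞) ≤ 32 := by norm_num
  refine ⟨fun α θ hs => ⟨C4_le_C0 hs, C5_le_C0_mul_C123 hs, ?_⟩,
    fun α θ h hs hh v _ => existsUnique_isCRInterpolant hs hh v,
    fun α θ h hs hh v hv p hp => ?_, 32, fun α θ hs => ⟨hM (C0_le hs) h4, hM (C12_le hs) h8,
      hM (C123_le hs) h8, hM (C4_le hs) h4, hM (C5_le hs) le_rfl⟩,
    fun α θ h hs hh v hv p hp => ⟨?_, ?_⟩⟩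
  · gcongr
    exact C123_le_C12 α θ 1
  · have e1 := h1Semi_sub_interpolant_le hs hh hv hp
    have e0 := l2Norm_sub_interpolant_le hs hh hv hp
    refine ⟨e1, e1.trans ?_, e0, e0.trans ?_, e0.trans ?_⟩
    · gcongr
      exact C4_le_C0 hs
    · gcongr
      exact C5_le_C0_mul_C123 hs
    · gcongr
      refine (C5_le_C0_mul_C123 hs).trans ?_
      gcongr
      exact C123_le_C12 α θ 1
  · refine (h1Semi_sub_interpolant_le hs hh hv hp).trans ?_
    gcongr
    exact hM (C4_le hs) h4
  · refine (l2Norm_sub_interpolant_le hs hh hv hp).trans ?_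
    gcongr
    exact hM (C5_le hs) le_rfl
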